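/- **Setting.** Consider first-order logic without equality over a language with predicates and functions of any arities and an infinite, totally ordered set of variables; $\models$ is entailment over structures with non-empty domain. *RQFO formulas* are generated by $$F ::= \top \mid \bot \mid F\land F \mid F \lor F \mid \forall \mathbf v\,(\lnot R \lor F) \mid \exists \mathbf v\,(R \land F),$$ where $\mathbf v$ is a (possibly empty) finite set of variables and $R$ is an atom whose arguments are variables or constants and in which all members of $\mathbf v$ occur. For RQFO $F$, $\lnot F$ denotes the RQFO formula obtained by propagating negation inwards. $\mathrm{pred}(F)$ is the set of predicates of $F$ paired with the polarities of their occurrences, $\mathrm{const}(F)$ the set of its constants. The *binding patterns* of $F$ are the triples $\langle -, r, \{i \mid t_i\notin\mathbf v\}\rangle$ (universal) for its subformulas $\forall\mathbf v(\lnot r(t_1,\dots,t_n)\lor F')$ and $\langle +, r, \{i \mid t_i\notin\mathbf v\}\rangle$ (existential) for its subformulas $\exists\mathbf v(r(t_1,\dots,t_n)\land F')$; $\langle S,r,O\rangle$ is *covered* by $\langle S,r,O'\rangle$ iff $O'\subseteq O$. For RQFO sentences $F\models G$, an *access interpolant* of $F$ and $G$ is an RQFO sentence $H$ such that (1) $F\models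 H\models G$; (2) $\mathrm{pred}(H)\subseteq\mathrm{pred}(F)\cap\mathrm{pred}(G)$; (3) every existential binding pattern of $H$ is covered by an existential one of $G$, and every universal binding pattern of $H$ by a universal one of $F$; (4) $\mathrm{const}(H)\subseteq\mathrm{const}(F)\cap\mathrm{const}(G)$. **Clausification.** Positions $p$ of $F$ address its subformulas $F|_p$ (words over $\{1,2\}$; the relativizing atom is not a subformula of its own). Let $\mathbf x_p$ be the sorted sequence of the free variables of $F|_p$, let $d_p$ be a fresh predicate, and $D_p = d_p(\mathbf x_p)$. Let $\mathrm{DEF}(F)$ be the conjunction of $D_\epsilon$ and, for all positions $p$, of $D_p\to\top$, $D_p\to\bot$, $\forall\mathbf x_p(D_p\to D_{p1}\land D_{p2})$, $\forall\mathbf x_p(D_p\to D_{p1}\lor D_{p2})$, $\forall\mathbf x_p(D_p\to\forall\mathbf v(\lnot R\lor D_{p1}))$, $\forall\mathbf x_p(D_p\to\exists\mathbf v(R\land D_{p1}))$ if $F|_p$ is $\top$, $\bot$, a conjunction, a disjunction, $\forall\mathbf v(\lnot R\lor F')$, $\exists\mathbf v(R\land F')$, respectively. For $F|_p=\exists\mathbf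 v(R\land F')$ let $\sigma_p$ map each $y\in\mathbf v$ to $f_{p,y}(\mathbf x_p)$ with a fresh Skolem function $f_{p,y}$. The clauses of $F$ are: (1) $D_\epsilon$; (2) $\lnot D_p$ for $F|_p=\bot$; (3) $\lnot D_p\lor D_{p1}$ and (4) $\lnot D_p\lor D_{p2}$ for conjunctions; (5) $\lnot D_p\lor D_{p1}\lor D_{p2}$ for disjunctions; (6) $\lnot D_p\lor\lnot R\lor D_{p1}$ for $F|_p=\forall\mathbf v(\lnot R\lor F')$; (7) $\lnot D_p\lor R\sigma_p$ and (8) $\lnot D_p\lor D_{p1}\sigma_p$ for $F|_p=\exists\mathbf v(R\land F')$. For two formulas disjoint sets of fresh symbols are used. **Tableaux.** An *ACI-tableau* for RQFO sentences $F$, $G$ is a finite ordered tree whose nodes except the root are labeled with a ground literal and a side, red or blue, siblings having the same side, such that: for each inner node $N$ the sequence of the literals of its children, read as a disjunction $\mathrm{clause}(N)$, is an instance of a clause of $F$ if the children are red, and of $\lnot G$ if they are blue; every leaf has an ancestor with complementary literal (closed); no node has an ancestor with the same literal (regular); negative literals label only leaves (leaf-only); and whenever two literals $R\sigma_p\mu$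 and $D_{p1}\sigma_p\mu$, for a position $p$ in $F$ or in $\lnot G$ with $(\cdot)|_p=\exists\mathbf v(R\land F')$ and a ground substitution $\mu$, label two nodes on the same branch, one of these is the parent of the other (contiguous). Let $\mathrm{branch}_S(N)$ be the conjunction of the literals with side $S$ that label $N$ and its ancestors, and let $\mathrm{garg}(E)$ be the set of ground terms that occur in $E$ as an argument of an atom. **Extraction.** For inner nodes $N$ with children $N_1,\dots,N_k$ define $\mathrm{aipol}(N)$ as follows. * $\mathrm{clause}(N)$ of form 1: $\mathrm{aipol}(N)=\mathrm{aipol}(N_1)$. * Forms 2–5, 7, 8: $\mathrm{aipol}(N)=\bigvee_{i=2}^k\mathrm{aipol}(N_i)$ if the children are red, $\bigwedge_{i=2}^k\mathrm{aipol}(N_i)$ if they are blue. * $\mathrm{clause}(N)=\lnot D\lor\lnot R\lor D'$ of form 6: let $N'$ be the ancestor of $N_2$ with literal $R$. If $N'$ has the same side as $N_1$, then $\mathrm{aipol}(N)=\mathrm{aipol}(N_3)$. If $N_1$ is red and $N'$ is blue, let $\{t_1,\dots,t_n\}=\mathrm{garg}(R)\setminus\mathrm{garg}(\mathrm{DEF}(F)\land\mathrm{branch}_{\rm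 red}(N))$, let $v_1,\dots,v_n$ be fresh variables, and let $\mathrm{aipol}(N)$ be $\forall v_1\dots\forall v_n(\lnot R\lor\mathrm{aipol}(N_3))$ with each $t_i$, wherever it is an argument of an atom, replaced by $v_i$. If $N_1$ is blue and $N'$ is red, let $\{t_1,\dots,t_n\}=\mathrm{garg}(R)\setminus\mathrm{garg}(\mathrm{DEF}(\lnot G)\land\mathrm{branch}_{\rm blue}(N))$ and let $\mathrm{aipol}(N)$ be $\exists v_1\dots\exists v_n(R\land\mathrm{aipol}(N_3))$ with the same replacement. **Theorem.** Let $F$, $G$ be RQFO sentences with $F\models G$ and let $N$ be the root of an ACI-tableau for $F$ and $G$. Then $\mathrm{aipol}(N)$ is defined and, for every choice of the fresh variables, it is an access interpolant of $F$ and $G$. -/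

import Mathlib

open scoped FirstOrder

universe u v w x

namespace AccessInterpolation

/-! ### Atoms, literals and formulas with relativized quantifiers -/

/-- The two sides of an interpolation problem: `red` for `F`, `blue` for `¬ G`. -/
inductive Side
  | red
  | blue
  deriving DecidableEq

/-- An atom `r(a₁, …, aₙ)` with a predicate of `L` and arguments from `A`. -/
structure Atom (L : FirstOrder.Language.{u, v}) (A : Type w) where
  arity : ℕ
  rel : L.Relations arity
  args : Fin arity → A

namespace Atom

variable {L : FirstOrder.Language.{u, v}} {A : Type w} {B : Type x}

/-- Apply a map to all the arguments of an atom. -/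
def map (f : A → B) (R : Atom L A) : Atom L B :=
  ⟨R.arity, R.rel, fun i => f (R.args i)⟩

/-- Read an atom in a larger language. -/
def inLang {L' : FirstOrder.Language} (φ : L →ᴸ L') (R : Atom L A) : Atom L' A :=
  ⟨R.arity, φ.onRelation R.rel, R.args⟩

/-- Truth of an atom over a structure. -/
def Holds {M : Type w} [L.Structure M] (R : Atom L M) : Prop :=
  FirstOrder.Language.Structure.RelMap R.rel R.args

/-- The set of arguments of an atom. -/
def parg (R : Atom L A) : Set A := Set.range R.args

end Atom

/-- A literal: `sign = true` for an atom, `sign = false` for a negated atom. -/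
structure Lit (L : FirstOrder.Language.{u, v}) (A : Type w) where
  sign : Bool
  atom : Atom L A

namespace Lit

variable {L : FirstOrder.Language.{u, v}} {A : Type w} {B : Type x}

/-- The complement of a literal. -/
def compl (l : Lit L A) : Lit L A := ⟨!l.sign, l.atom⟩

/-- Apply a map to all the arguments of a literal. -/
def map (f : A → B) (l : Lit L A) : Lit L B := ⟨l.sign, l.atom.map f⟩

end Lit

/-- Raw formulas with relativized quantifiers. The argument of an atom is either a variable
(`Sum.inl`) or a ground term (`Sum.inr`) from `T`. Here `all vs R F` is `∀ vs (¬ R ∨ F)` and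
`ex vs R F` is `∃ vs (R ∧ F)`; the condition that all members of `vs` occur in `R` is
`RQ.Relativized`. -/
inductive RQ (L : FirstOrder.Language.{u, v}) (V : Type x) (T : Type w)
  | top : RQ L V T
  | bot : RQ L V T
  | and : RQ L V T → RQ L V T → RQ L V T
  | or : RQ L V T → RQ L V T → RQ L V T
  | all : Finset V → Atom L (V ⊕ T) → RQ L V T → RQ L V T
  | ex : Finset V → Atom L (V ⊕ T) → RQ L V T → RQ L V T

/-- Relational formulas: the only ground terms are the constants of the language. -/
abbrev RQFO (L : FirstOrder.Language.{u, v}) (V : Type x) := RQ L V L.Constants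

/-- A binding pattern: `sign = true` is existential, `sign = false` is universal. -/
structure BindingPattern (L : FirstOrder.Language.{u, v}) where
  sign : Bool
  predicate : Σ n, L.Relations n
  input : Set (Fin predicate.1)

/-- `⟨S, P, O⟩` is covered by `⟨S, P, O'⟩` if and only if `O' ⊆ O`. -/
inductive BindingPattern.Covered {L : FirstOrder.Language.{u, v}} :
    BindingPattern L → BindingPattern L → Prop
  | mk (S : Bool) (P : Σ n, L.Relations n) (O O' : Set (Fin P.1)) (h : O' ⊆ O) :
      Covered ⟨S, P, O⟩ ⟨S, P, O'⟩

namespace RQ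

variable {L : FirstOrder.Language.{u, v}} {V : Type x} {T : Type w}

/-- Negation, propagated inwards. -/
def neg : RQ L V T → RQ L V T
  | top => bot
  | bot => top
  | and F G => or (neg F) (neg G)
  | or F G => and (neg F) (neg G)
  | all vs R F => ex vs R (neg F)
  | ex vs R F => all vs R (neg F)

/-- All quantified variables occur in the relativizing atom of their quantifier. -/
def Relativized : RQ L V T → Prop
  | top => True
  | bot => True
  | and F G => Relativized F ∧ Relativized G
  | or F G => Relativized F ∧ Relativized G
  | all vs R F => (∀ y ∈ vs, Sum.inl y ∈ R.parg) ∧ Relativized F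
  | ex vs R F => (∀ y ∈ vs, Sum.inl y ∈ R.parg) ∧ Relativized F

/-- The variables of an atom. -/
def atomVars [DecidableEq V] (R : Atom L (V ⊕ T)) : Finset V :=
  Finset.univ.biUnion fun i => Sum.elim (fun y => {y}) (fun _ => ∅) (R.args i)

/-- The free variables of a formula. -/
def fv [DecidableEq V] : RQ L V T → Finset V
  | top => ∅
  | bot => ∅
  | and F G => fv F ∪ fv G
  | or F G => fv F ∪ fv G
  | all vs R F => (atomVars R ∪ fv F) \ vs
  | ex vs R F => (atomVars R ∪ fv F) \ vs

/-- The variables that occur in a formula, free or bound. -/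
def vars [DecidableEq V] : RQ L V T → Finset V
  | top => ∅
  | bot => ∅
  | and F G => vars F ∪ vars G
  | or F G => vars F ∪ vars G
  | all vs R F => vs ∪ atomVars R ∪ vars F
  | ex vs R F => vs ∪ atomVars R ∪ vars F

/-- Being a sentence of first-order logic with relativized quantifiers. -/
def IsSentence [DecidableEq V] (F : RQ L V T) : Prop := F.Relativized ∧ F.fv = ∅

/-- The predicates that occur in a formula, with the polarities of their occurrences. -/
def pred : RQ L V T → Set (Bool × Σ n, L.Relations n)
  | top => ∅
  | bot => ∅
  | and F G => pred F ∪ pred G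
  | or F G => pred F ∪ pred G
  | all _ R F => {(false, ⟨R.arity, R.rel⟩)} ∪ pred F
  | ex _ R F => {(true, ⟨R.arity, R.rel⟩)} ∪ pred F

/-- The ground terms that occur in a formula as an argument of an atom. For `T = L.Constants`
these are the constants of the formula. -/
def garg : RQ L V T → Set T
  | top => ∅
  | bot => ∅
  | and F G => garg F ∪ garg G
  | or F G => garg F ∪ garg G
  | all _ R F => {t | Sum.inr t ∈ R.parg} ∪ garg F
  | ex _ R F => {t | Sum.inr t ∈ R.parg} ∪ garg F

/-- The binding patterns of a formula. -/
def bpatt : RQ L V T → Set (BindingPattern L)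
  | top => ∅
  | bot => ∅
  | and F G => bpatt F ∪ bpatt G
  | or F G => bpatt F ∪ bpatt G
  | all vs R F => {⟨false, ⟨R.arity, R.rel⟩, {i | ∀ y ∈ vs, R.args i ≠ Sum.inl y}⟩} ∪ bpatt F
  | ex vs R F => {⟨true, ⟨R.arity, R.rel⟩, {i | ∀ y ∈ vs, R.args i ≠ Sum.inl y}⟩} ∪ bpatt F

/-- Truth in a structure, under an interpretation `e` of the ground terms and a valuation `a`
of the variables. -/
def Sat {M : Type*} [L.Structure M] (e : T → M) : (V → M) → RQ L V T → Prop
  | _, top => True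
  | _, bot => False
  | a, and F G => Sat e a F ∧ Sat e a G
  | a, or F G => Sat e a F ∨ Sat e a G
  | a, all vs R F => ∀ b : V → M, (∀ y, y ∉ vs → b y = a y) →
      ¬ (R.map (Sum.elim b e)).Holds ∨ Sat e b F
  | a, ex vs R F => ∃ b : V → M, (∀ y, y ∉ vs → b y = a y) ∧
      (R.map (Sum.elim b e)).Holds ∧ Sat e b F

/-- Apply a map to all arguments of atoms, leaving quantifier prefixes unchanged. -/
def mapArgs {T' : Type*} (f : V ⊕ T → V ⊕ T') : RQ L V T → RQ L V T'
  | top => top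
  | bot => bot
  | and F G => and (mapArgs f F) (mapArgs f G)
  | or F G => or (mapArgs f F) (mapArgs f G)
  | all vs R F => all vs (R.map f) (mapArgs f F)
  | ex vs R F => ex vs (R.map f) (mapArgs f F)

open Classical in
/-- Inverse substitution of ground arguments of atoms: every member `t` of `ts` that occurs as an
argument of an atom is replaced by the variable `θ t`. -/
noncomputable def invSubst (ts : Set T) (θ : T → V) (F : RQ L V T) : RQ L V T :=
  F.mapArgs (Sum.elim Sum.inl fun t => if t ∈ ts then Sum.inl (θ t) else Sum.inr t)

/-- Finite disjunctions. -/
def bigOr : List (RQ L V T) → RQ L V T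
  | [] => bot
  | [F] => F
  | F :: Fs => or F (bigOr Fs)

/-- Finite conjunctions. -/
def bigAnd : List (RQ L V T) → RQ L V T
  | [] => top
  | [F] => F
  | F :: Fs => and F (bigAnd Fs)

/-- The positions of a formula. -/
def poss : RQ L V T → List (List ℕ)
  | top => [([] : List ℕ)]
  | bot => [([] : List ℕ)]
  | and F G => [] :: (F.poss.map (List.cons 1) ++ G.poss.map (List.cons 2))
  | or F G => [] :: (F.poss.map (List.cons 1) ++ G.poss.map (List.cons 2))
  | all _ _ F => [] :: F.poss.map (List.cons 1)
  | ex _ _ F => [] :: F.poss.map (List.cons 1)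

/-- The subformula at a position (`none` if there is no such position). -/
def subAt : RQ L V T → List ℕ → Option (RQ L V T)
  | F, [] => some F
  | and F _, 1 :: p => subAt F p
  | and _ G, 2 :: p => subAt G p
  | or F _, 1 :: p => subAt F p
  | or _ G, 2 :: p => subAt G p
  | all _ _ F, 1 :: p => subAt F p
  | ex _ _ F, 1 :: p => subAt F p
  | _, _ :: _ => none

end RQ

/-- Entailment of relational formulas: over all structures with a non-empty domain. -/
def Entails {L : FirstOrder.Language.{u, v}} {V : Type x} (F G : RQFO L V) : Prop :=
  ∀ (M : Type w) [Nonempty M] [L.Structure M] (a : V → M),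
    F.Sat (fun c : L.Constants => (c : M)) a → G.Sat (fun c : L.Constants => (c : M)) a

/-- Access interpolants. -/
structure IsAccessInterpolant {L : FirstOrder.Language.{u, v}} {V : Type x} [DecidableEq V]
    (F G H : RQFO L V) : Prop where
  sentence : H.IsSentence
  left : Entails.{u, v, w, x} F H
  right : Entails.{u, v, w, x} H G
  lyndon : H.pred ⊆ F.pred ∩ G.pred
  existential : ∀ b ∈ H.bpatt, b.sign = true → ∃ b' ∈ G.bpatt, b.Covered b'
  universal : ∀ b ∈ H.bpatt, b.sign = false → ∃ b' ∈ F.bpatt, b.Covered b'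
  constants : H.garg ⊆ F.garg ∩ G.garg

/-! ### The language extended by definer predicates and Skolem functions -/

/-- The auxiliary symbols: for each side `s` and position `p` a definer predicate, and for each
side `s`, position `p` and variable `y` (to be quantified existentially at `p`) a Skolem function.
Each is available in every arity; only one arity is used. -/
def auxLanguage (V : Type x) : FirstOrder.Language.{x, 0} where
  Functions := fun _ => Side × List ℕ × V
  Relations := fun _ => Side × List ℕ

/-- The language `L` with fresh auxiliary symbols added. -/
abbrev Ext (L : FirstOrder.Language.{u, v}) (V : Type x) := L.sum (auxLanguage V)

/-- Ground terms of the extended language. -/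
abbrev GTerm (L : FirstOrder.Language.{u, v}) (V : Type x) := (Ext L V).Term Empty

/-- Formulas with relativized quantifiers whose atoms may have arbitrary ground terms of the
extended language as arguments. -/
abbrev RQFOT (L : FirstOrder.Language.{u, v}) (V : Type x) := RQ L V (GTerm L V)

section Clausification

variable {L : FirstOrder.Language.{u, v}} {V : Type x}

/-- A constant of `L` as a term of the extended language. -/
def constTerm {A : Type*} (c : L.Constants) : (Ext L V).Term A :=
  FirstOrder.Language.Constants.term (L := Ext L V) (Sum.inl c)

/-- Relational formulas as formulas with ground terms. -/
def RQ.toRQFOT (F : RQFO L V) : RQFOT L V :=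
  F.mapArgs (Sum.map id constTerm)

/-- First-order formulas over the extended language in which all terms are variables or ground;
quantification is upon finite sets of variables. -/
inductive Fml (L : FirstOrder.Language.{u, v}) (V : Type x)
  | top : Fml L V
  | bot : Fml L V
  | atom : Atom (Ext L V) (V ⊕ GTerm L V) → Fml L V
  | neg : Fml L V → Fml L V
  | and : Fml L V → Fml L V → Fml L V
  | or : Fml L V → Fml L V → Fml L V
  | all : Finset V → Fml L V → Fml L V
  | ex : Finset V → Fml L V → Fml L V

namespace Fml

/-- Implication. -/
def imp (A B : Fml L V) : Fml L V := or (neg A) B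

/-- Finite conjunctions. -/
def bigAnd (Fs : List (Fml L V)) : Fml L V := Fs.foldr and top

/-- The ground terms that occur as an argument of an atom. -/
def garg : Fml L V → Set (GTerm L V)
  | top => ∅
  | bot => ∅
  | atom A => {t | Sum.inr t ∈ A.parg}
  | neg F => garg F
  | and F G => garg F ∪ garg G
  | or F G => garg F ∪ garg G
  | all _ F => garg F
  | ex _ F => garg F

end Fml

variable [LinearOrder V]

/-- The free variables of a formula, in the standard order of variables. -/
def sortedVars (F : RQFO L V) : List V := F.fv.sort (· ≤ ·)

/-- The atom `D_p` of the definer predicate for position `p`, where `F` is the subformula at `p`;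
its arguments are the free variables of `F` in the standard order. -/
def definer (s : Side) (p : List ℕ) (F : RQFO L V) : Atom (Ext L V) V :=
  ⟨(sortedVars F).length, Sum.inr (s, p), (sortedVars F).get⟩

/-- `D_p` as a first-order formula. -/
def definerFml (s : Side) (p : List ℕ) (F : RQFO L V) : Fml L V :=
  .atom ((definer s p F).map Sum.inl)

/-- A relativizing atom as a first-order formula. -/
def relFml (R : Atom L (V ⊕ L.Constants)) : Fml L V :=
  .atom ((R.inLang FirstOrder.Language.LHom.sumInl).map (Sum.map id constTerm))

/-- The definitional implication for the subformula `F` at position `p`. -/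
def defImp (s : Side) (p : List ℕ) (F : RQFO L V) : Fml L V :=
  match F with
  | .top => .imp (definerFml s p F) .top
  | .bot => .imp (definerFml s p F) .bot
  | .and G H => .all F.fv (.imp (definerFml s p F)
      (.and (definerFml s (p ++ [1]) G) (definerFml s (p ++ [2]) H)))
  | .or G H => .all F.fv (.imp (definerFml s p F)
      (.or (definerFml s (p ++ [1]) G) (definerFml s (p ++ [2]) H)))
  | .all vs R G => .all F.fv (.imp (definerFml s p F)
      (.all vs (.or (.neg (relFml R)) (definerFml s (p ++ [1]) G))))
  | .ex vs R G => .all F.fv (.imp (definerFml s p F)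
      (.ex vs (.and (relFml R) (definerFml s (p ++ [1]) G))))

/-- The definitional form of a formula, with the definer predicates of side `s`. -/
def defForm (s : Side) (F : RQFO L V) : Fml L V :=
  .and (definerFml s [] F)
    (.bigAnd (F.poss.filterMap fun p => (F.subAt p).map (defImp s p)))

/-- Literals of clauses, with variables. -/
abbrev CLit (L : FirstOrder.Language.{u, v}) (V : Type x) := Lit (Ext L V) ((Ext L V).Term V)

/-- Ground literals. -/
abbrev GLit (L : FirstOrder.Language.{u, v}) (V : Type x) := Lit (Ext L V) (GTerm L V)

/-- `D_p` as an atom of a clause. -/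
def definerAtom (s : Side) (p : List ℕ) (F : RQFO L V) : Atom (Ext L V) ((Ext L V).Term V) :=
  (definer s p F).map FirstOrder.Language.Term.var

/-- A relativizing atom as an atom of a clause. -/
def relAtom (R : Atom L (V ⊕ L.Constants)) : Atom (Ext L V) ((Ext L V).Term V) :=
  (R.inLang FirstOrder.Language.LHom.sumInl).map (Sum.elim FirstOrder.Language.Term.var constTerm)

/-- The Skolem substitution `σ_p` for the subformula `F = ∃ vs (…)` at position `p`. It maps each
`y ∈ vs` to the Skolem function for `p` and `y`, applied to the free variables of `F`. -/
def skolem (s : Side) (p : List ℕ) (vs : Finset V) (F : RQFO L V) (y : V) :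
    (Ext L V).Term V :=
  if y ∈ vs then
    FirstOrder.Language.Term.func (l := (sortedVars F).length) (Sum.inr (s, p, y))
      fun i => FirstOrder.Language.Term.var ((sortedVars F).get i)
  else FirstOrder.Language.Term.var y

/-- `R_p σ_p`. -/
def skRelAtom (s : Side) (p : List ℕ) (vs : Finset V) (R : Atom L (V ⊕ L.Constants))
    (G : RQFO L V) : Atom (Ext L V) ((Ext L V).Term V) :=
  (relAtom R).map fun t => t.subst (skolem s p vs (.ex vs R G))

/-- `D_{p1} σ_p`. -/
def skDefinerAtom (s : Side) (p : List ℕ) (vs : Finset V) (R : Atom L (V ⊕ L.Constants))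
    (G : RQFO L V) : Atom (Ext L V) ((Ext L V).Term V) :=
  (definerAtom s (p ++ [1]) G).map fun t => t.subst (skolem s p vs (.ex vs R G))

/-- The forms of the clauses obtained from the definitional form. -/
inductive ClauseForm
  | unit
  | bot
  | andLeft
  | andRight
  | or
  | all
  | exRel
  | exSub

/-- The clauses of the definitional clausification of `F` for side `s`. -/
inductive IsClause (s : Side) (F : RQFO L V) : ClauseForm → List (CLit L V) → Prop
  | unit : IsClause s F .unit [⟨true, definerAtom s [] F⟩]
  | bot {p : List ℕ} (h : F.subAt p = some .bot) :
      IsClause s F .bot [⟨false, definerAtom s p (.bot : RQFO L V)⟩]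
  | andLeft {p : List ℕ} {G H : RQFO L V} (h : F.subAt p = some (.and G H)) :
      IsClause s F .andLeft
        [⟨false, definerAtom s p (.and G H)⟩, ⟨true, definerAtom s (p ++ [1]) G⟩]
  | andRight {p : List ℕ} {G H : RQFO L V} (h : F.subAt p = some (.and G H)) :
      IsClause s F .andRight
        [⟨false, definerAtom s p (.and G H)⟩, ⟨true, definerAtom s (p ++ [2]) H⟩]
  | or {p : List ℕ} {G H : RQFO L V} (h : F.subAt p = some (.or G H)) :
      IsClause s F .or
        [⟨false, definerAtom s p (.or G H)⟩, ⟨true, definerAtom s (p ++ [1]) G⟩,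
          ⟨true, definerAtom s (p ++ [2]) H⟩]
  | all {p : List ℕ} {vs : Finset V} {R : Atom L (V ⊕ L.Constants)} {G : RQFO L V}
      (h : F.subAt p = some (.all vs R G)) :
      IsClause s F .all
        [⟨false, definerAtom s p (.all vs R G)⟩, ⟨false, relAtom R⟩,
          ⟨true, definerAtom s (p ++ [1]) G⟩]
  | exRel {p : List ℕ} {vs : Finset V} {R : Atom L (V ⊕ L.Constants)} {G : RQFO L V}
      (h : F.subAt p = some (.ex vs R G)) :
      IsClause s F .exRel
        [⟨false, definerAtom s p (.ex vs R G)⟩, ⟨true, skRelAtom s p vs R G⟩]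
  | exSub {p : List ℕ} {vs : Finset V} {R : Atom L (V ⊕ L.Constants)} {G : RQFO L V}
      (h : F.subAt p = some (.ex vs R G)) :
      IsClause s F .exSub
        [⟨false, definerAtom s p (.ex vs R G)⟩, ⟨true, skDefinerAtom s p vs R G⟩]

/-- `c` is a ground instance of a clause of the given form. -/
def IsClauseInstance (s : Side) (F : RQFO L V) (form : ClauseForm) (c : List (GLit L V)) : Prop :=
  ∃ d, IsClause s F form d ∧
    ∃ μ : V → GTerm L V, c = d.map (Lit.map fun t => t.subst μ)

end Clausification

/-! ### Tableaux -/

/-- Finite ordered trees whose nodes, except the root, are labeled with a literal (from `Λ`) and a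
side. The labels of the children are stored at their parent; siblings share the side `s`, and
`lit i` is the literal label of the `i`-th child, which is the root of the subtree `sub i`. -/
inductive Tab (Λ : Type w)
  | leaf : Tab Λ
  | inner (s : Side) (k : ℕ) (lit : Fin k → Λ) (sub : Fin k → Tab Λ) : Tab Λ

/-- `NodeAt T B N`: the tree `T` has a node with subtree `N` such that `B` is the list of the
labels of that node and of its ancestors (except the root), from the node upwards. -/
inductive Tab.NodeAt {Λ : Type w} (T : Tab Λ) : List (Side × Λ) → Tab Λ → Prop
  | root : NodeAt T [] T
  | child {B : List (Side × Λ)} {s : Side} {k : ℕ} {lit : Fin k → Λ} {sub : Fin k → Tab Λ}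
      (h : NodeAt T B (.inner s k lit sub)) (i : Fin k) : NodeAt T ((s, lit i) :: B) (sub i)

section Tableaux

variable {L : FirstOrder.Language.{u, v}} {V : Type x}

/-- Two-sided ground tableaux over the extended language. -/
abbrev GTab (L : FirstOrder.Language.{u, v}) (V : Type x) := Tab (GLit L V)

/-- Every leaf has an ancestor with complementary literal label. -/
def IsClosed (T : GTab L V) : Prop :=
  ∀ B, T.NodeAt B .leaf → ∃ s l B', B = (s, l) :: B' ∧ ∃ s', (s', l.compl) ∈ B'

/-- No node has an ancestor with the same literal label. -/
def IsRegular (T : GTab L V) : Prop :=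
  ∀ s l B N, T.NodeAt ((s, l) :: B) N → ∀ s', (s', l) ∉ B

/-- Negative literals do not occur as labels of inner nodes. -/
def IsLeafOnlyNegative (T : GTab L V) : Prop :=
  ∀ s l B s' k lit sub, T.NodeAt ((s, l) :: B) (.inner s' k lit sub) → l.sign = true

/-- Whenever `l` and `l'` are labels of two nodes on the same branch, one of the nodes is the
parent of the other. -/
def IsContiguousFor (T : GTab L V) (l l' : GLit L V) : Prop :=
  ∀ B N, T.NodeAt B N → ∀ i j s s', B[i]? = some (s, l) → B[j]? = some (s', l') →
    i = j + 1 ∨ j = i + 1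

/-- The formula that is clausified for a side: `F` for `red` and `¬ G` for `blue`. -/
def sideFml (F G : RQFO L V) : Side → RQFO L V
  | .red => F
  | .blue => G.neg

/-- The conjunction of the literal labels with side `s` on the branch `B`. -/
def branchFml (s : Side) (B : List (Side × GLit L V)) : Fml L V :=
  .bigAnd ((B.filter fun n => n.1 = s).map fun n =>
    if n.2.sign then .atom (n.2.atom.map Sum.inr) else .neg (.atom (n.2.atom.map Sum.inr)))

variable [LinearOrder V]

/-- The children of each inner node are labeled with an instance of a clause of their side. -/
def IsTableauFor (F G : RQFO L V) (T : GTab L V) : Prop :=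
  ∀ B s k lit sub, T.NodeAt B (.inner s k lit sub) →
    ∃ form, IsClauseInstance s (sideFml F G s) form (List.ofFn lit)

/-- ACI-tableaux for `F` and `G`. -/
structure IsACITableau (F G : RQFO L V) (T : GTab L V) : Prop where
  tableau : IsTableauFor F G T
  closed : IsClosed T
  regular : IsRegular T
  leafOnly : IsLeafOnlyNegative T
  contiguous : ∀ (s : Side) (p : List ℕ) (vs : Finset V) (R : Atom L (V ⊕ L.Constants))
    (K : RQFO L V), (sideFml F G s).subAt p = some (.ex vs R K) → ∀ μ : V → GTerm L V,
      IsContiguousFor T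
        ⟨true, (skRelAtom s p vs R K).map fun t => t.subst μ⟩
        ⟨true, (skDefinerAtom s p vs R K).map fun t => t.subst μ⟩

/-- The finite set `ts` of ground terms to be lifted at a relativized quantifier of side `s`:
those arguments of `R` that are arguments neither of the definitional form of side `s` nor of the
labels of side `s` on the branch `B`. The set `vs` consists of the fresh variables `θ t`, for
`t ∈ ts`, where fresh means pairwise different and not occurring in `H`. -/
def IsLifting (F G : RQFO L V) (s : Side) (B : List (Side × GLit L V)) (R : Atom L (GTerm L V))
    (H : RQFOT L V) (ts : Set (GTerm L V)) (θ : GTerm L V → V) (vs : Finset V) : Prop :=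
  ts = R.parg \ (Fml.and (defForm s (sideFml F G s)) (branchFml s B)).garg ∧
    Set.InjOn θ ts ∧ (∀ t ∈ ts, θ t ∉ H.vars) ∧ (vs : Set V) = θ '' ts

/-- `IsAipol F G B N H`: the formula `H` is a value of access interpolant extraction at the node
with subtree `N`, where `B` is the list of the labels of the node and of its ancestors. The value
depends on a choice of fresh variables. -/
inductive IsAipol (F G : RQFO L V) :
    List (Side × GLit L V) → GTab L V → RQFOT L V → Prop
  | unit {B : List (Side × GLit L V)} {s : Side} {lit : Fin 1 → GLit L V}
      {sub : Fin 1 → GTab L V} {H : RQFOT L V}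
      (hc : IsClauseInstance s (sideFml F G s) .unit (List.ofFn lit))
      (h : IsAipol F G ((s, lit 0) :: B) (sub 0) H) :
      IsAipol F G B (.inner s 1 lit sub) H
  | disj {B : List (Side × GLit L V)} {k : ℕ} {lit : Fin (k + 1) → GLit L V}
      {sub : Fin (k + 1) → GTab L V} {H : Fin k → RQFOT L V} {form : ClauseForm}
      (hform : form ≠ .unit ∧ form ≠ .all)
      (hc : IsClauseInstance .red (sideFml F G .red) form (List.ofFn lit))
      (h : ∀ i, IsAipol F G ((.red, lit i.succ) :: B) (sub i.succ) (H i)) :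
      IsAipol F G B (.inner .red (k + 1) lit sub) (.bigOr (List.ofFn H))
  | conj {B : List (Side × GLit L V)} {k : ℕ} {lit : Fin (k + 1) → GLit L V}
      {sub : Fin (k + 1) → GTab L V} {H : Fin k → RQFOT L V} {form : ClauseForm}
      (hform : form ≠ .unit ∧ form ≠ .all)
      (hc : IsClauseInstance .blue (sideFml F G .blue) form (List.ofFn lit))
      (h : ∀ i, IsAipol F G ((.blue, lit i.succ) :: B) (sub i.succ) (H i)) :
      IsAipol F G B (.inner .blue (k + 1) lit sub) (.bigAnd (List.ofFn H))
  | sameSide {B : List (Side × GLit L V)} {s : Side} {lit : Fin 3 → GLit L V}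
      {sub : Fin 3 → GTab L V} {H : RQFOT L V}
      (hc : IsClauseInstance s (sideFml F G s) .all (List.ofFn lit))
      (htgt : (s, (lit 1).compl) ∈ B)
      (h : IsAipol F G ((s, lit 2) :: B) (sub 2) H) :
      IsAipol F G B (.inner s 3 lit sub) H
  | all {B : List (Side × GLit L V)} {lit : Fin 3 → GLit L V} {sub : Fin 3 → GTab L V}
      {H : RQFOT L V} {R : Atom L (GTerm L V)} {ts : Set (GTerm L V)} {θ : GTerm L V → V}
      {vs : Finset V}
      (hc : IsClauseInstance .red (sideFml F G .red) .all (List.ofFn lit))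
      (htgt : (.blue, (lit 1).compl) ∈ B)
      (hR : lit 1 = ⟨false, R.inLang FirstOrder.Language.LHom.sumInl⟩)
      (h : IsAipol F G ((.red, lit 2) :: B) (sub 2) H)
      (hθ : IsLifting F G .red B R H ts θ vs) :
      IsAipol F G B (.inner .red 3 lit sub)
        ((RQ.all vs (R.map Sum.inr) H).invSubst ts θ)
  | ex {B : List (Side × GLit L V)} {lit : Fin 3 → GLit L V} {sub : Fin 3 → GTab L V}
      {H : RQFOT L V} {R : Atom L (GTerm L V)} {ts : Set (GTerm L V)} {θ : GTerm L V → V}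
      {vs : Finset V}
      (hc : IsClauseInstance .blue (sideFml F G .blue) .all (List.ofFn lit))
      (htgt : (.red, (lit 1).compl) ∈ B)
      (hR : lit 1 = ⟨false, R.inLang FirstOrder.Language.LHom.sumInl⟩)
      (h : IsAipol F G ((.blue, lit 2) :: B) (sub 2) H)
      (hθ : IsLifting F G .blue B R H ts θ vs) :
      IsAipol F G B (.inner .blue 3 lit sub)
        ((RQ.ex vs (R.map Sum.inr) H).invSubst ts θ)

end Tableaux

end AccessInterpolation

/-! The proof rests on an invariant, `IsBranchInterpolant`, of the value `H` extracted at a node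
with branch `B`. The formula `H` has the required syntactic shape (`Admissible`). Its ground
arguments belong to `sideGarg` of both sides, that is, they are constants of the formula of the side
or arguments of labels of that side on `B`. Finally, `H` is true whenever the red formula and the
red labels on `B` are true, and false whenever the blue ones are. At the root `B` is empty: the
ground arguments are then constants common to `F` and `G`, and the two semantic conditions say that
`F` entails `H` and that `H` is inconsistent with `¬ G`.

Skolem functions are never interpreted. A ground term is a mere name to which `e` assigns any
element of the domain, and a definer atom means the subformula that it abbreviates (`ExtHolds`).
Names can be given new values independently of each other, and this is harmless for a side on which
they are not arguments. Two kinds of steps use this.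

At an existential clause the truth of `D_p` supplies witnesses, which become the new values of the
Skolem terms (`IsACITableau.branchHolds_skolem`). The labels already on the branch must survive, and
so must the truth value of `H`. It is therefore essential that above the new label the Skolem terms
occur at most in the partner literal of the same Skolem pair, and not at all on the other side.
Regularity and contiguity give this (`IsACITableau.skolem_occurrence`). If the partner is on the
branch, its witnesses have to be chosen anew, because the branch records only that the partner
literal holds.

At a universal clause whose atom `R` is a label of the other side, the lifted terms do not occur on
the side of the clause. That side thus holds for all their values, which justifies the quantifier.
On the other side `R` is true, and the current values of the lifted terms instantiate the quantifier
(`IsACITableau.isBranchInterpolant_all`, `IsACITableau.isBranchInterpolant_ex`). An argument of `R`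
at a position not bound by the quantifier of the clause is a constant or an argument of `D_p`, hence
is not lifted; this gives the coverage of binding patterns (`IsACITableau.covered_of_isLifting`). -/

namespace AccessInterpolation

open FirstOrder FirstOrder.Language

/-! ### Formulas: truth, negation and replacement of arguments -/

namespace RQ

variable {L : FirstOrder.Language.{u, v}} {V : Type x} {T : Type w}

theorem mem_atomVars [DecidableEq V] {R : Atom L (V ⊕ T)} {y : V} :
    y ∈ atomVars R ↔ Sum.inl y ∈ R.parg := by
  simp only [atomVars, Finset.mem_biUnion, Finset.mem_univ, true_and, Atom.parg, Set.mem_range]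
  refine exists_congr fun i => ?_
  rcases R.args i with z | t <;> simp [eq_comm]

theorem atom_holds_congr {M : Type*} [L.Structure M] {A B : Type*} {f : A → M} {g : B → M}
    {n : ℕ} {r : L.Relations n} {s : Fin n → A} {t : Fin n → B}
    (h : ∀ i, f (s i) = g (t i)) :
    (Atom.map f ⟨n, r, s⟩).Holds ↔ (Atom.map g ⟨n, r, t⟩).Holds := by
  simp only [Atom.Holds, Atom.map, h]

/-- One implication suffices for `sat_congr`, since the hypotheses are symmetric. The lemma is what
permits giving new values to terms that are not arguments of a formula. -/
theorem sat_imp_of_eqOn [DecidableEq V] {M : Type*} [L.Structure M] {e e' : T → M} (F : RQ L V T)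
    {a a' : V → M} (ha : ∀ x ∈ F.fv, a x = a' x) (he : ∀ t ∈ F.garg, e t = e' t)
    (h : F.Sat e a) : F.Sat e' a' := by
  have key : ∀ (R : Atom L (V ⊕ T)) (b b' : V → M),
      (∀ x ∈ atomVars R, b x = b' x) → (∀ t, Sum.inr t ∈ R.parg → e t = e' t) →
      ((R.map (Sum.elim b e)).Holds ↔ (R.map (Sum.elim b' e')).Holds) := by
    intro R b b' hb he
    apply atom_holds_congr
    intro i
    cases hi : R.args i with
    | inl y => exact hb y (mem_atomVars.2 ⟨i, hi⟩)
    | inr t => exact he t ⟨i, hi⟩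
  induction F generalizing a a' with
  | top => trivial
  | bot => exact h
  | and F G ihF ihG =>
    exact ⟨ihF (fun x hx => ha x (by simp [fv, hx])) (fun t ht => he t (Or.inl ht)) h.1,
      ihG (fun x hx => ha x (by simp [fv, hx])) (fun t ht => he t (Or.inr ht)) h.2⟩
  | or F G ihF ihG =>
    exact h.imp (ihF (fun x hx => ha x (by simp [fv, hx])) (fun t ht => he t (Or.inl ht)))
      (ihG (fun x hx => ha x (by simp [fv, hx])) (fun t ht => he t (Or.inr ht)))
  | all vs R F ih =>
    intro b' hb'
    -- The hypothesis is used at `b'` on the quantified variables and `a` elsewhere, which agrees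
    -- with `b'` on every variable that matters.
    let b : V → M := fun y => if y ∈ vs then b' y else a y
    have hbb : ∀ x, x ∈ atomVars R ∪ F.fv → b x = b' x := by
      intro x hx
      by_cases hxv : x ∈ vs
      · simp [b, hxv]
      · rw [hb' x hxv, ← ha x (by simp only [fv, Finset.mem_sdiff]; exact ⟨hx, hxv⟩)]
        simp [b, hxv]
    refine (h b (fun y hy => by simp [b, hy])).imp (mt ?_) ?_
    · exact (key R b b' (fun x hx => hbb x (Finset.mem_union_left _ hx))
        fun t ht => he t (Or.inl ht)).2
    · exact ih (fun x hx => hbb x (Finset.mem_union_right _ hx)) fun t ht => he t (Or.inr ht)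
  | ex vs R F ih =>
    obtain ⟨b, hb, hR, hF⟩ := h
    let b' : V → M := fun y => if y ∈ vs then b y else a' y
    have hbb : ∀ x, x ∈ atomVars R ∪ F.fv → b x = b' x := by
      intro x hx
      by_cases hxv : x ∈ vs
      · simp [b', hxv]
      · rw [hb x hxv, ha x (by simp only [fv, Finset.mem_sdiff]; exact ⟨hx, hxv⟩)]
        simp [b', hxv]
    refine ⟨b', fun y hy => by simp [b', hy], ?_, ?_⟩
    · exact (key R b b' (fun x hx => hbb x (Finset.mem_union_left _ hx))
        fun t ht => he t (Or.inl ht)).1 hR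
    · exact ih (fun x hx => hbb x (Finset.mem_union_right _ hx)) (fun t ht => he t (Or.inr ht)) hF

theorem sat_congr [DecidableEq V] {M : Type*} [L.Structure M] {e e' : T → M} (F : RQ L V T)
    {a a' : V → M} (ha : ∀ x ∈ F.fv, a x = a' x) (he : ∀ t ∈ F.garg, e t = e' t) :
    F.Sat e a ↔ F.Sat e' a' :=
  ⟨F.sat_imp_of_eqOn ha he,
    F.sat_imp_of_eqOn (fun x hx => (ha x hx).symm) fun t ht => (he t ht).symm⟩

theorem sat_neg {M : Type*} [L.Structure M] {e : T → M} (F : RQ L V T) {a : V → M} :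
    F.neg.Sat e a ↔ ¬ F.Sat e a := by
  induction F generalizing a with
  | top => simp [neg, Sat]
  | bot => simp [neg, Sat]
  | and F G ihF ihG => simp only [neg, Sat, ihF, ihG, not_and_or]
  | or F G ihF ihG => simp only [neg, Sat, ihF, ihG, not_or]
  | all vs R F ih =>
    simp only [neg, Sat, ih]
    push Not
    rfl
  | ex vs R F ih =>
    simp only [neg, Sat, ih]
    push Not
    exact forall_congr' fun b => forall_congr' fun _ => imp_iff_not_or.symm

theorem fv_neg [DecidableEq V] (F : RQ L V T) : F.neg.fv = F.fv := by
  induction F <;> simp_all [neg, fv]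

theorem garg_neg (F : RQ L V T) : F.neg.garg = F.garg := by
  induction F <;> simp_all [neg, garg]

theorem relativized_neg (F : RQ L V T) : F.neg.Relativized ↔ F.Relativized := by
  induction F <;> simp_all [neg, Relativized]

theorem mem_pred_neg (F : RQ L V T) {b : Bool} {P : Σ n, L.Relations n} :
    (b, P) ∈ F.neg.pred ↔ (!b, P) ∈ F.pred := by
  induction F <;> cases b <;> simp_all [neg, pred]

theorem mem_bpatt_neg (F : RQ L V T) {b : Bool} {P : Σ n, L.Relations n} {O : Set (Fin P.1)} :
    (⟨b, P, O⟩ : BindingPattern L) ∈ F.neg.bpatt ↔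
      (⟨!b, P, O⟩ : BindingPattern L) ∈ F.bpatt := by
  induction F <;> cases b <;> simp_all [neg, bpatt]

theorem sat_mapArgs_inr {T' : Type*} {M : Type*} [L.Structure M] (g : T → T') {e : T' → M}
    (F : RQ L V T) {a : V → M} :
    (F.mapArgs (Sum.map id g)).Sat e a ↔ F.Sat (e ∘ g) a := by
  have key : ∀ (R : Atom L (V ⊕ T)) (b : V → M), ((R.map (Sum.map id g)).map (Sum.elim b e)).Holds ↔
      (R.map (Sum.elim b (e ∘ g))).Holds := by
    intro R b
    apply atom_holds_congr
    intro i
    cases R.args i <;> rfl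
  induction F generalizing a <;> simp_all [mapArgs, Sat]

/-- Freshness excludes capture: no quantifier inside `F` binds a variable `θ t`, so this variable
keeps the value of the term that it replaces under all changes of valuation by quantifiers. -/
theorem sat_invSubst [DecidableEq V] {M : Type*} [L.Structure M] {e e' : T → M} {ts : Set T}
    {θ : T → V} (F : RQ L V T) {a : V → M} (hθ : ∀ t ∈ ts, θ t ∉ F.vars)
    (h1 : ∀ t ∈ ts, e' t = a (θ t)) (h2 : ∀ t, t ∉ ts → e' t = e t) :
    (F.invSubst ts θ).Sat e a ↔ F.Sat e' a := by
  classical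
  have key : ∀ (R : Atom L (V ⊕ T)) (b : V → M), (∀ t ∈ ts, e' t = b (θ t)) →
      (((R.map (Sum.elim Sum.inl fun t => if t ∈ ts then Sum.inl (θ t) else Sum.inr t)).map
        (Sum.elim b e)).Holds ↔ (R.map (Sum.elim b e')).Holds) := by
    intro R b hb
    apply atom_holds_congr
    intro i
    cases R.args i with
    | inl y => rfl
    | inr t =>
      by_cases ht : t ∈ ts
      · simp [ht, hb]
      · simp [ht, h2]
  have hstep : ∀ {vs : Finset V} {b : V → M}, (∀ t ∈ ts, θ t ∉ vs) → (∀ t ∈ ts, e' t = a (θ t)) →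
      (∀ y, y ∉ vs → b y = a y) → ∀ t ∈ ts, e' t = b (θ t) := by
    intro vs b hv ha hb t ht
    rw [ha t ht, hb _ (hv t ht)]
  unfold invSubst
  induction F generalizing a with
  | top => rfl
  | bot => rfl
  | and F G ihF ihG =>
    exact and_congr (ihF (fun t ht h => hθ t ht (by simp [vars, h])) h1 @hstep)
      (ihG (fun t ht h => hθ t ht (by simp [vars, h])) h1 @hstep)
  | or F G ihF ihG =>
    exact or_congr (ihF (fun t ht h => hθ t ht (by simp [vars, h])) h1 @hstep)
      (ihG (fun t ht h => hθ t ht (by simp [vars, h])) h1 @hstep)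
  | all vs R F ih =>
    refine forall_congr' fun b => forall_congr' fun hb => ?_
    have hb' := hstep (fun t ht h => hθ t ht (by simp [vars, h])) h1 hb
    refine or_congr (not_congr (key R b hb')) (ih (fun t ht h => hθ t ht (by simp [vars, h])) hb' ?_)
    intro vs b hv ha hb t ht
    rw [ha t ht, hb _ (hv t ht)]
  | ex vs R F ih =>
    refine exists_congr fun b => and_congr_right fun hb => ?_
    have hb' := hstep (fun t ht h => hθ t ht (by simp [vars, h])) h1 hb
    refine and_congr (key R b hb') (ih (fun t ht h => hθ t ht (by simp [vars, h])) hb' ?_)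
    intro vs b hv ha hb t ht
    rw [ha t ht, hb _ (hv t ht)]

theorem pred_mapArgs {T' : Type*} (f : V ⊕ T → V ⊕ T') (F : RQ L V T) :
    (F.mapArgs f).pred = F.pred := by
  induction F <;> simp_all [mapArgs, pred, Atom.map]

theorem relativized_mapArgs {T' : Type*} {f : V ⊕ T → V ⊕ T'} (hf : ∀ y, f (Sum.inl y) = Sum.inl y)
    {F : RQ L V T} (h : F.Relativized) : (F.mapArgs f).Relativized := by
  have key : ∀ (R : Atom L (V ⊕ T)) y, Sum.inl y ∈ R.parg → Sum.inl y ∈ (R.map f).parg := by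
    rintro R y ⟨i, hi⟩
    exact ⟨i, by simp [Atom.map, hi, hf]⟩
  induction F with
  | top => trivial
  | bot => trivial
  | and F G ihF ihG => exact ⟨ihF h.1, ihG h.2⟩
  | or F G ihF ihG => exact ⟨ihF h.1, ihG h.2⟩
  | all vs R F ih => exact ⟨fun y hy => key R y (h.1 y hy), ih h.2⟩
  | ex vs R F ih => exact ⟨fun y hy => key R y (h.1 y hy), ih h.2⟩

/-- Binding patterns do not change if no argument is mapped to or from a quantified variable. -/
theorem bpatt_mapArgs [DecidableEq V] {T' : Type*} {f : V ⊕ T → V ⊕ T'} (F : RQ L V T)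
    (hf : ∀ A, ∀ y ∈ F.vars, f A = Sum.inl y ↔ A = Sum.inl y) :
    (F.mapArgs f).bpatt = F.bpatt := by
  have key : ∀ (vs : Finset V) (R : Atom L (V ⊕ T)),
      (∀ A, ∀ y ∈ vs, f A = Sum.inl y ↔ A = Sum.inl y) →
      {i | ∀ y ∈ vs, (R.map f).args i ≠ Sum.inl y} = {i | ∀ y ∈ vs, R.args i ≠ Sum.inl y} := by
    intro vs R h
    ext i
    exact forall_congr' fun y => forall_congr' fun hy => not_congr (h _ y hy)
  induction F with
  | top => rfl
  | bot => rfl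
  | and F G ihF ihG =>
    simp only [mapArgs, bpatt]
    rw [ihF fun A y hy => hf A y (by simp [vars, hy]), ihG fun A y hy => hf A y (by simp [vars, hy])]
  | or F G ihF ihG =>
    simp only [mapArgs, bpatt]
    rw [ihF fun A y hy => hf A y (by simp [vars, hy]), ihG fun A y hy => hf A y (by simp [vars, hy])]
  | all vs R F ih =>
    simp only [mapArgs, bpatt]
    rw [ih fun A y hy => hf A y (by simp [vars, hy])]
    congr 2
    exact congrArg (BindingPattern.mk false ⟨R.arity, R.rel⟩)
      (key vs R fun A y hy => hf A y (by simp [vars, hy]))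
  | ex vs R F ih =>
    simp only [mapArgs, bpatt]
    rw [ih fun A y hy => hf A y (by simp [vars, hy])]
    congr 2
    exact congrArg (BindingPattern.mk true ⟨R.arity, R.rel⟩)
      (key vs R fun A y hy => hf A y (by simp [vars, hy]))

theorem bpatt_invSubst [DecidableEq V] {ts : Set T} {θ : T → V} (F : RQ L V T)
    (hθ : ∀ t ∈ ts, θ t ∉ F.vars) : (F.invSubst ts θ).bpatt = F.bpatt := by
  refine bpatt_mapArgs F ?_
  rintro (z | t) y hy
  · simp
  · by_cases ht : t ∈ ts
    · simp only [Sum.elim_inr, ht, if_true, Sum.inl.injEq, reduceCtorEq, iff_false]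
      rintro rfl
      exact hθ t ht hy
    · simp [ht]

theorem garg_invSubst {ts : Set T} {θ : T → V} (F : RQ L V T) :
    (F.invSubst ts θ).garg = F.garg \ ts := by
  classical
  have key : ∀ R : Atom L (V ⊕ T), {t | Sum.inr t ∈ (R.map (Sum.elim Sum.inl fun t =>
      if t ∈ ts then Sum.inl (θ t) else Sum.inr t)).parg} = {t | Sum.inr t ∈ R.parg} \ ts := by
    intro R
    ext t
    simp only [Atom.parg, Atom.map, Set.mem_range, Set.mem_ofPred_eq, Set.mem_sdiff]
    constructor
    · rintro ⟨i, hi⟩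
      cases h : R.args i with
      | inl y => simp [h] at hi
      | inr t' =>
        by_cases ht' : t' ∈ ts
        · simp [h, ht'] at hi
        · simp only [h, Sum.elim_inr, ht', if_false, Sum.inr.injEq] at hi
          subst hi
          exact ⟨⟨i, h⟩, ht'⟩
    · rintro ⟨⟨i, hi⟩, ht⟩
      exact ⟨i, by simp [hi, ht]⟩
  unfold invSubst
  induction F with
  | top => simp [mapArgs, garg]
  | bot => simp [mapArgs, garg]
  | and F G ihF ihG => simp only [mapArgs, garg, ihF, ihG, Set.union_sdiff_distrib]
  | or F G ihF ihG => simp only [mapArgs, garg, ihF, ihG, Set.union_sdiff_distrib]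
  | all vs R F ih => simp only [mapArgs, garg, ih, Set.union_sdiff_distrib, ← key]
  | ex vs R F ih => simp only [mapArgs, garg, ih, Set.union_sdiff_distrib, ← key]

theorem atomVars_map_subset [DecidableEq V] {T' : Type*} {f : V ⊕ T → V ⊕ T'} {W : Finset V}
    (R : Atom L (V ⊕ T)) (hf : ∀ A, ∀ y, f A = Sum.inl y → A = Sum.inl y ∨ y ∈ W) :
    atomVars (R.map f) ⊆ atomVars R ∪ W := by
  intro y hy
  obtain ⟨i, hi⟩ := mem_atomVars.1 hy
  rw [Finset.mem_union]
  exact (hf _ _ hi).imp (fun h => mem_atomVars.2 ⟨i, h⟩) id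

theorem fv_mapArgs_subset [DecidableEq V] {T' : Type*} {f : V ⊕ T → V ⊕ T'} {W : Finset V}
    (F : RQ L V T) (hf : ∀ A, ∀ y, f A = Sum.inl y → A = Sum.inl y ∨ y ∈ W) :
    (F.mapArgs f).fv ⊆ F.fv ∪ W := by
  have key := fun R : Atom L (V ⊕ T) => atomVars_map_subset R hf
  induction F with
  | top => simp [mapArgs, fv]
  | bot => simp [mapArgs, fv]
  | and F G ihF ihG =>
    intro y; have h1 := @ihF y; have h2 := @ihG y
    simp only [mapArgs, fv, Finset.mem_union] at *; tauto
  | or F G ihF ihG =>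
    intro y; have h1 := @ihF y; have h2 := @ihG y
    simp only [mapArgs, fv, Finset.mem_union] at *; tauto
  | all vs R F ih =>
    intro y; have h1 := @ih y; have h2 := @key R y
    simp only [mapArgs, fv, Finset.mem_union, Finset.mem_sdiff] at *; tauto
  | ex vs R F ih =>
    intro y; have h1 := @ih y; have h2 := @key R y
    simp only [mapArgs, fv, Finset.mem_union, Finset.mem_sdiff] at *; tauto

theorem fv_invSubst_subset [DecidableEq V] {ts : Set T} {θ : T → V} {vs : Finset V}
    (hvs : (vs : Set V) = θ '' ts) (F : RQ L V T) : (F.invSubst ts θ).fv ⊆ F.fv ∪ vs := by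
  refine fv_mapArgs_subset F ?_
  rintro (z | t) y h
  · exact Or.inl h
  · by_cases ht : t ∈ ts
    · simp only [Sum.elim_inr, ht, if_true, Sum.inl.injEq] at h
      right
      rw [← Finset.mem_coe, hvs]
      exact ⟨t, ht, h⟩
    · simp [ht] at h

/-- A formula whose ground arguments all have preimages is an image. -/
theorem exists_mapArgs_eq {T' : Type*} (g : T → T') (F : RQ L V T')
    (h : F.garg ⊆ Set.range g) : ∃ F' : RQ L V T, F = F'.mapArgs (Sum.map id g) := by
  have key : ∀ R : Atom L (V ⊕ T'), {t | Sum.inr t ∈ R.parg} ⊆ Set.range g →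
      ∃ R' : Atom L (V ⊕ T), R = R'.map (Sum.map id g) := by
    rintro ⟨n, r, args⟩ hR
    have : ∀ i, ∃ A : V ⊕ T, args i = Sum.map id g A := by
      intro i
      cases hi : args i with
      | inl y => exact ⟨Sum.inl y, rfl⟩
      | inr t =>
        obtain ⟨t', rfl⟩ := hR (show t ∈ {t | Sum.inr t ∈ (Atom.mk n r args).parg} from ⟨i, hi⟩)
        exact ⟨Sum.inr t', rfl⟩
    choose args' hargs using this
    exact ⟨⟨n, r, args'⟩, by simp only [Atom.map, ← hargs]⟩
  induction F with
  | top => exact ⟨top, rfl⟩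
  | bot => exact ⟨bot, rfl⟩
  | and F G ihF ihG =>
    obtain ⟨F', rfl⟩ := ihF fun t ht => h (Or.inl ht)
    obtain ⟨G', rfl⟩ := ihG fun t ht => h (Or.inr ht)
    exact ⟨and F' G', rfl⟩
  | or F G ihF ihG =>
    obtain ⟨F', rfl⟩ := ihF fun t ht => h (Or.inl ht)
    obtain ⟨G', rfl⟩ := ihG fun t ht => h (Or.inr ht)
    exact ⟨or F' G', rfl⟩
  | all vs R F ih =>
    obtain ⟨F', rfl⟩ := ih fun t ht => h (Or.inr ht)
    obtain ⟨R', rfl⟩ := key R fun t ht => h (Or.inl ht)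
    exact ⟨all vs R' F', rfl⟩
  | ex vs R F ih =>
    obtain ⟨F', rfl⟩ := ih fun t ht => h (Or.inr ht)
    obtain ⟨R', rfl⟩ := key R fun t ht => h (Or.inl ht)
    exact ⟨ex vs R' F', rfl⟩

/-! ### Maps of the ground terms -/

section MapInr

variable {T' : Type*} (g : T → T')

theorem inl_mem_parg_map {R : Atom L (V ⊕ T)} {y : V} :
    Sum.inl y ∈ (R.map (Sum.map id g)).parg ↔ Sum.inl y ∈ R.parg := by
  refine exists_congr fun i => ?_
  change Sum.map id g (R.args i) = _ ↔ _
  cases R.args i <;> simp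

theorem relativized_mapArgs_inr {F : RQ L V T} :
    (F.mapArgs (Sum.map id g)).Relativized ↔ F.Relativized := by
  induction F <;> simp_all [mapArgs, Relativized, inl_mem_parg_map]

theorem fv_mapArgs_inr [DecidableEq V] (F : RQ L V T) :
    (F.mapArgs (Sum.map id g)).fv = F.fv := by
  have key : ∀ R : Atom L (V ⊕ T), atomVars (R.map (Sum.map id g)) = atomVars R := by
    intro R; ext y; simp [mem_atomVars, inl_mem_parg_map]
  induction F <;> simp_all [mapArgs, fv]

theorem bpatt_mapArgs_inr [DecidableEq V] (F : RQ L V T) :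
    (F.mapArgs (Sum.map id g)).bpatt = F.bpatt := by
  refine bpatt_mapArgs F ?_
  rintro (z | t) y - <;> simp

theorem garg_mapArgs_inr (F : RQ L V T) :
    (F.mapArgs (Sum.map id g)).garg = g '' F.garg := by
  have key : ∀ R : Atom L (V ⊕ T),
      {t | Sum.inr t ∈ (R.map (Sum.map id g)).parg} = g '' {t | Sum.inr t ∈ R.parg} := by
    intro R
    ext t
    constructor
    · rintro ⟨i, hi⟩
      change Sum.map id g (R.args i) = _ at hi
      cases h : R.args i with
      | inl y => simp [h] at hi
      | inr t' => exact ⟨t', ⟨i, h⟩, by simpa [h] using hi⟩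
    · rintro ⟨t', ⟨i, hi⟩, rfl⟩
      exact ⟨i, by simp [Atom.map, hi]⟩
  induction F <;> simp_all [mapArgs, garg, Set.image_union]

end MapInr

/-! ### Finite conjunctions and disjunctions -/

section Big

theorem sat_bigOr {M : Type*} [L.Structure M] {e : T → M} {a : V → M} :
    ∀ Fs : List (RQ L V T), (bigOr Fs).Sat e a ↔ ∃ F ∈ Fs, F.Sat e a
  | [] => by simp [bigOr, Sat]
  | [F] => by simp [bigOr]
  | F :: G :: Fs => by simp [bigOr, Sat, sat_bigOr (G :: Fs)]

theorem sat_bigAnd {M : Type*} [L.Structure M] {e : T → M} {a : V → M} :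
    ∀ Fs : List (RQ L V T), (bigAnd Fs).Sat e a ↔ ∀ F ∈ Fs, F.Sat e a
  | [] => by simp [bigAnd, Sat]
  | [F] => by simp [bigAnd]
  | F :: G :: Fs => by simp [bigAnd, Sat, sat_bigAnd (G :: Fs)]

/-- Properties of formulas that pass through conjunctions and disjunctions. -/
theorem bigOr_induction {P : RQ L V T → Prop} (hbot : P bot) (hor : ∀ F G, P F → P G → P (or F G)) :
    ∀ Fs : List (RQ L V T), (∀ F ∈ Fs, P F) → P (bigOr Fs)
  | [], _ => hbot
  | [F], h => h F (by simp)
  | F :: G :: Fs, h => hor _ _ (h F (by simp))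
      (bigOr_induction hbot hor (G :: Fs) fun K hK => h K (List.mem_cons_of_mem _ hK))

theorem bigAnd_induction {P : RQ L V T → Prop} (htop : P top)
    (hand : ∀ F G, P F → P G → P (and F G)) :
    ∀ Fs : List (RQ L V T), (∀ F ∈ Fs, P F) → P (bigAnd Fs)
  | [], _ => htop
  | [F], h => h F (by simp)
  | F :: G :: Fs, h => hand _ _ (h F (by simp))
      (bigAnd_induction htop hand (G :: Fs) fun K hK => h K (List.mem_cons_of_mem _ hK))

end Big

/-! ### Subformulas at positions -/

section SubAt

/-- Properties that pass from formulas to their immediate subformulas hold at all positions. -/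
theorem subAt_induction {P : RQ L V T → List ℕ → RQ L V T → Prop} (hnil : ∀ F, P F [] F)
    (hand1 : ∀ F G p K, P F p K → P (and F G) (1 :: p) K)
    (hand2 : ∀ F G p K, P G p K → P (and F G) (2 :: p) K)
    (hor1 : ∀ F G p K, P F p K → P (or F G) (1 :: p) K)
    (hor2 : ∀ F G p K, P G p K → P (or F G) (2 :: p) K)
    (hall : ∀ vs R F p K, P F p K → P (all vs R F) (1 :: p) K)
    (hex : ∀ vs R F p K, P F p K → P (ex vs R F) (1 :: p) K) :
    ∀ (F : RQ L V T) (p : List ℕ) (K : RQ L V T), F.subAt p = some K → P F p K := by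
  intro F p
  induction F, p using RQ.subAt.induct with
  | case1 F => intro K h; simp only [subAt, Option.some.injEq] at h; subst h; exact hnil F
  | case2 F G p ih => intro K h; exact hand1 _ _ _ _ (ih K (by simpa [subAt] using h))
  | case3 F G p ih => intro K h; exact hand2 _ _ _ _ (ih K (by simpa [subAt] using h))
  | case4 F G p ih => intro K h; exact hor1 _ _ _ _ (ih K (by simpa [subAt] using h))
  | case5 F G p ih => intro K h; exact hor2 _ _ _ _ (ih K (by simpa [subAt] using h))
  | case6 vs R F p ih => intro K h; exact hall _ _ _ _ _ (ih K (by simpa [subAt] using h))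
  | case7 vs R F p ih => intro K h; exact hex _ _ _ _ _ (ih K (by simpa [subAt] using h))
  | case8 F i p h1 h2 h3 h4 h5 h6 => intro K h; rw [subAt] at h <;> first | assumption | cases h

variable {F K : RQ L V T} {p : List ℕ}

theorem subAt_append (h : F.subAt p = some K) (q : List ℕ) : F.subAt (p ++ q) = K.subAt q := by
  revert h
  refine fun h => subAt_induction (P := fun F p K => F.subAt (p ++ q) = K.subAt q)
    (fun _ => rfl) ?_ ?_ ?_ ?_ ?_ ?_ F p K h <;>
  · intros
    simpa [subAt]

theorem pred_subset_of_subAt (h : F.subAt p = some K) : K.pred ⊆ F.pred :=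
  subAt_induction (P := fun F _ K => K.pred ⊆ F.pred) (fun _ => subset_rfl)
    (fun _ _ _ _ h => h.trans Set.subset_union_left)
    (fun _ _ _ _ h => h.trans Set.subset_union_right)
    (fun _ _ _ _ h => h.trans Set.subset_union_left)
    (fun _ _ _ _ h => h.trans Set.subset_union_right)
    (fun _ _ _ _ _ h => h.trans Set.subset_union_right)
    (fun _ _ _ _ _ h => h.trans Set.subset_union_right) F p K h

theorem bpatt_subset_of_subAt (h : F.subAt p = some K) : K.bpatt ⊆ F.bpatt :=
  subAt_induction (P := fun F _ K => K.bpatt ⊆ F.bpatt) (fun _ => subset_rfl)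
    (fun _ _ _ _ h => h.trans Set.subset_union_left)
    (fun _ _ _ _ h => h.trans Set.subset_union_right)
    (fun _ _ _ _ h => h.trans Set.subset_union_left)
    (fun _ _ _ _ h => h.trans Set.subset_union_right)
    (fun _ _ _ _ _ h => h.trans Set.subset_union_right)
    (fun _ _ _ _ _ h => h.trans Set.subset_union_right) F p K h

theorem garg_subset_of_subAt (h : F.subAt p = some K) : K.garg ⊆ F.garg :=
  subAt_induction (P := fun F _ K => K.garg ⊆ F.garg) (fun _ => subset_rfl)
    (fun _ _ _ _ h => h.trans Set.subset_union_left)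
    (fun _ _ _ _ h => h.trans Set.subset_union_right)
    (fun _ _ _ _ h => h.trans Set.subset_union_left)
    (fun _ _ _ _ h => h.trans Set.subset_union_right)
    (fun _ _ _ _ _ h => h.trans Set.subset_union_right)
    (fun _ _ _ _ _ h => h.trans Set.subset_union_right) F p K h

theorem relativized_of_subAt (h : F.subAt p = some K) : F.Relativized → K.Relativized :=
  subAt_induction (P := fun F _ K => F.Relativized → K.Relativized) (fun _ => id)
    (fun _ _ _ _ h h' => h h'.1) (fun _ _ _ _ h h' => h h'.2)
    (fun _ _ _ _ h h' => h h'.1) (fun _ _ _ _ h h' => h h'.2)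
    (fun _ _ _ _ _ h h' => h h'.2) (fun _ _ _ _ _ h h' => h h'.2) F p K h

theorem mem_poss_of_subAt (h : F.subAt p = some K) : p ∈ F.poss :=
  subAt_induction (P := fun F p _ => p ∈ F.poss) (fun F => by cases F <;> simp [poss])
    (fun _ _ _ _ h => by simp [poss, h]) (fun _ _ _ _ h => by simp [poss, h])
    (fun _ _ _ _ h => by simp [poss, h]) (fun _ _ _ _ h => by simp [poss, h])
    (fun _ _ _ _ _ h => by simp [poss, h]) (fun _ _ _ _ _ h => by simp [poss, h]) F p K h

end SubAt

end RQ

/-! ### Ground instances, Skolem terms and ground clauses -/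

section Ground

variable {L : FirstOrder.Language.{u, v}} {V : Type x}

theorem constTerm_subst {A B : Type*} (c : L.Constants) (μ : A → (Ext L V).Term B) :
    (constTerm c : (Ext L V).Term A).subst μ = constTerm c := by
  simp only [constTerm, Constants.term, Term.subst]
  congr 1
  funext i
  exact i.elim0

theorem constTerm_injective : Function.Injective (constTerm : L.Constants → GTerm L V) := by
  intro c d h
  have key : ∀ {f g : (Ext L V).Functions 0} {a b : Fin 0 → GTerm L V},
      Term.func f a = Term.func g b → f = g := by
    intro f g a b h
    cases h
    rfl
  exact Sum.inl_injective (key h)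

/-- An instance of a relativizing atom. -/
def relGround (R : Atom L (V ⊕ L.Constants)) (ν : V → GTerm L V) : Atom (Ext L V) (GTerm L V) :=
  (R.inLang LHom.sumInl).map (Sum.elim ν constTerm)

/-- The predicate of an atom: a predicate of `L`, or the side and position of a definer. -/
def Atom.head {A : Type*} (R : Atom (Ext L V) A) : (Σ n, L.Relations n) ⊕ (Side × List ℕ) :=
  Sum.elim (fun r => Sum.inl ⟨R.arity, r⟩) Sum.inr R.rel

theorem relGround_eq_inLang (R : Atom L (V ⊕ L.Constants)) (ν : V → GTerm L V) :
    relGround R ν = (R.map (Sum.elim ν constTerm)).inLang LHom.sumInl := rfl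

theorem relAtom_subst (R : Atom L (V ⊕ L.Constants)) (μ : V → GTerm L V) :
    ((relAtom R).map fun t => t.subst μ) = relGround R μ := by
  simp only [relAtom, relGround, Atom.map]
  congr 1
  funext i
  simp only [Atom.inLang]
  cases R.args i with
  | inl y => rfl
  | inr c => exact constTerm_subst c μ

theorem mem_parg_relGround {R : Atom L (V ⊕ L.Constants)} {ν : V → GTerm L V} {t : GTerm L V} :
    t ∈ (relGround R ν).parg ↔
      (∃ y, Sum.inl y ∈ R.parg ∧ t = ν y) ∨ ∃ c, Sum.inr c ∈ R.parg ∧ t = constTerm c := by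
  constructor
  · rintro ⟨i, rfl⟩
    change (∃ y, _ ∧ Sum.elim ν constTerm (R.args i) = _) ∨
      ∃ c, _ ∧ Sum.elim ν constTerm (R.args i) = _
    cases h : R.args i with
    | inl y => exact Or.inl ⟨y, ⟨i, h⟩, rfl⟩
    | inr c => exact Or.inr ⟨c, ⟨i, h⟩, rfl⟩
  · rintro (⟨y, ⟨i, hi⟩, rfl⟩ | ⟨c, ⟨i, hi⟩, rfl⟩)
    · exact ⟨i, by simp [relGround, Atom.map, Atom.inLang, hi]⟩
    · exact ⟨i, by simp [relGround, Atom.map, Atom.inLang, hi]⟩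

/-- The two arities may differ a priori, so the arguments are compared as lists. -/
theorem func_inr_inj {n m : ℕ} {q q' : Side × List ℕ × V} {ts : Fin n → GTerm L V}
    {ts' : Fin m → GTerm L V}
    (h : Term.func (L := Ext L V) (l := n) (Sum.inr q) ts =
      Term.func (L := Ext L V) (l := m) (Sum.inr q') ts') :
    q = q' ∧ List.ofFn ts = List.ofFn ts' := by
  cases h
  exact ⟨rfl, rfl⟩

/-- No argument of a ground term is a ground term with the same arguments. -/
theorem arg_ne_func {n : ℕ} (f : (Ext L V).Functions n) (ts : Fin n → GTerm L V) (i : Fin n) :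
    ts i ≠ Term.func f ts := by
  -- Descent: if the argument `ts i` equals `func f ts`, then it is itself a term with arguments
  -- `ts`, and the induction hypothesis for this argument applies to the same `ts` and `i`.
  suffices H : ∀ t : GTerm L V, ∀ n (g f : (Ext L V).Functions n) (ts : Fin n → GTerm L V) i,
      t = Term.func g ts → ts i ≠ Term.func f ts from H _ n f f ts i rfl
  intro t
  induction t with
  | var a => exact a.elim
  | func g ss ih =>
    intro n g' f ts i h hi
    cases h
    exact ih i _ f f ss i hi hi

variable [LinearOrder V]

theorem mem_sortedVars {K : RQFO L V} {y : V} : y ∈ sortedVars K ↔ y ∈ K.fv := by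
  simp [sortedVars]

/-- An instance of the atom of a definer predicate. -/
def definerGround (s : Side) (p : List ℕ) (K : RQFO L V) (ν : V → GTerm L V) :
    Atom (Ext L V) (GTerm L V) :=
  (definer s p K).map ν

theorem definerAtom_subst (s : Side) (p : List ℕ) (K : RQFO L V) (μ : V → GTerm L V) :
    ((definerAtom s p K).map fun t => t.subst μ) = definerGround s p K μ := rfl

theorem mem_parg_definerGround {s : Side} {p : List ℕ} {K : RQFO L V} {ν : V → GTerm L V}
    {t : GTerm L V} : t ∈ (definerGround s p K ν).parg ↔ ∃ y ∈ K.fv, t = ν y := by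
  constructor
  · rintro ⟨i, rfl⟩
    exact ⟨(sortedVars K).get i, mem_sortedVars.1 (List.get_mem _ _), rfl⟩
  · rintro ⟨y, hy, rfl⟩
    obtain ⟨i, rfl⟩ := List.mem_iff_get.1 (mem_sortedVars.2 hy)
    exact ⟨i, rfl⟩

/-- A ground instance of the Skolem substitution for the subformula `∃ vs (R ∧ K)` at `p`. -/
def skolemGround (s : Side) (p : List ℕ) (vs : Finset V) (R : Atom L (V ⊕ L.Constants))
    (K : RQFO L V) (μ : V → GTerm L V) (y : V) : GTerm L V :=
  (skolem s p vs (.ex vs R K) y).subst μ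

variable {s : Side} {p : List ℕ} {vs : Finset V} {R : Atom L (V ⊕ L.Constants)} {K : RQFO L V}
  {μ : V → GTerm L V} {y : V}

theorem skolemGround_of_mem (hy : y ∈ vs) : skolemGround s p vs R K μ y =
    Term.func (L := Ext L V) (l := (sortedVars (.ex vs R K : RQFO L V)).length) (Sum.inr (s, p, y))
      fun i => μ ((sortedVars (.ex vs R K : RQFO L V)).get i) := by
  simp [skolemGround, skolem, hy, Term.subst]

theorem skolemGround_of_notMem (hy : y ∉ vs) : skolemGround s p vs R K μ y = μ y := by
  simp [skolemGround, skolem, hy, Term.subst]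

theorem skolemGround_ne_constTerm (hy : y ∈ vs) (c : L.Constants) :
    skolemGround s p vs R K μ y ≠ constTerm c := by
  rw [skolemGround_of_mem hy]
  intro h
  have key : ∀ {n m : ℕ} {q : Side × List ℕ × V} {c : L.Functions m} {ts : Fin n → GTerm L V}
      {ts' : Fin m → GTerm L V}, Term.func (L := Ext L V) (l := n) (Sum.inr q) ts ≠
      Term.func (L := Ext L V) (l := m) (Sum.inl c) ts' := by
    intro n m q c ts ts' h
    cases h
  exact key h

/-- The term `μ z` is an argument of the Skolem term. Hence new values for the Skolem terms do not
disturb the values of the free variables of the existential formula. -/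
theorem skolemGround_ne_of_mem_fv (hy : y ∈ vs) {z : V} (hz : z ∈ (.ex vs R K : RQFO L V).fv) :
    μ z ≠ skolemGround s p vs R K μ y := by
  rw [skolemGround_of_mem hy]
  obtain ⟨i, rfl⟩ := List.mem_iff_get.1 (mem_sortedVars.2 hz)
  exact arg_ne_func _ (fun i => μ ((sortedVars (.ex vs R K : RQFO L V)).get i)) i

/-- A Skolem function symbol records side, position and variable, so a Skolem term reveals its
origin. Its arguments determine `μ` on the free variables, which is all that the two literals of the
pair depend on. -/
theorem skolemGround_inj {s' : Side} {p' : List ℕ} {vs' : Finset V}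
    {R' : Atom L (V ⊕ L.Constants)} {K' : RQFO L V} {μ' : V → GTerm L V} {y' : V}
    (hy : y ∈ vs) (hy' : y' ∈ vs')
    (h : skolemGround s p vs R K μ y = skolemGround s' p' vs' R' K' μ' y') :
    s = s' ∧ p = p' ∧ y = y' ∧ (sortedVars (.ex vs R K : RQFO L V)).map μ =
      (sortedVars (.ex vs' R' K' : RQFO L V)).map μ' := by
  rw [skolemGround_of_mem hy, skolemGround_of_mem hy'] at h
  obtain ⟨h1, h2⟩ := func_inr_inj h
  simp only [Prod.mk.injEq] at h1
  refine ⟨h1.1, h1.2.1, h1.2.2, ?_⟩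
  simpa [List.ofFn_getElem_eq_map] using h2

theorem skRelAtom_subst : ((skRelAtom s p vs R K).map fun t => t.subst μ) =
    relGround R (skolemGround s p vs R K μ) := by
  simp only [skRelAtom, relAtom, relGround, Atom.map]
  congr 1
  funext i
  simp only [Atom.inLang]
  cases R.args i with
  | inl y => rfl
  | inr c => simp only [Sum.elim_inr, constTerm_subst]

theorem skDefinerAtom_subst : ((skDefinerAtom s p vs R K).map fun t => t.subst μ) =
    definerGround s (p ++ [1]) K (skolemGround s p vs R K μ) := rfl

theorem relGround_congr {ν ν' : V → GTerm L V} (h : ∀ y ∈ RQ.atomVars R, ν y = ν' y) :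
    relGround R ν = relGround R ν' := by
  simp only [relGround, Atom.map]
  congr 1
  funext i
  simp only [Atom.inLang]
  cases hi : R.args i with
  | inl y => exact h y (RQ.mem_atomVars.2 ⟨i, hi⟩)
  | inr c => rfl

theorem definerGround_congr {ν ν' : V → GTerm L V} (h : ∀ y ∈ K.fv, ν y = ν' y) :
    definerGround s p K ν = definerGround s p K ν' := by
  simp only [definerGround, Atom.map]
  congr 1
  funext i
  exact h _ (mem_sortedVars.1 (List.get_mem _ _))

/-- The ground instances of the clauses of `F`. -/
inductive GroundClause (s : Side) (F : RQFO L V) : ClauseForm → List (GLit L V) → Prop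
  | unit (μ : V → GTerm L V) : GroundClause s F .unit [⟨true, definerGround s [] F μ⟩]
  | bot {p : List ℕ} (h : F.subAt p = some .bot) (μ : V → GTerm L V) :
      GroundClause s F .bot [⟨false, definerGround s p .bot μ⟩]
  | andLeft {p : List ℕ} {G H : RQFO L V} (h : F.subAt p = some (.and G H)) (μ : V → GTerm L V) :
      GroundClause s F .andLeft
        [⟨false, definerGround s p (.and G H) μ⟩, ⟨true, definerGround s (p ++ [1]) G μ⟩]
  | andRight {p : List ℕ} {G H : RQFO L V} (h : F.subAt p = some (.and G H)) (μ : V → GTerm L V) :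
      GroundClause s F .andRight
        [⟨false, definerGround s p (.and G H) μ⟩, ⟨true, definerGround s (p ++ [2]) H μ⟩]
  | or {p : List ℕ} {G H : RQFO L V} (h : F.subAt p = some (.or G H)) (μ : V → GTerm L V) :
      GroundClause s F .or
        [⟨false, definerGround s p (.or G H) μ⟩, ⟨true, definerGround s (p ++ [1]) G μ⟩,
          ⟨true, definerGround s (p ++ [2]) H μ⟩]
  | all {p : List ℕ} {vs : Finset V} {R : Atom L (V ⊕ L.Constants)} {G : RQFO L V}
      (h : F.subAt p = some (.all vs R G)) (μ : V → GTerm L V) :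
      GroundClause s F .all
        [⟨false, definerGround s p (.all vs R G) μ⟩, ⟨false, relGround R μ⟩,
          ⟨true, definerGround s (p ++ [1]) G μ⟩]
  | exRel {p : List ℕ} {vs : Finset V} {R : Atom L (V ⊕ L.Constants)} {G : RQFO L V}
      (h : F.subAt p = some (.ex vs R G)) (μ : V → GTerm L V) :
      GroundClause s F .exRel
        [⟨false, definerGround s p (.ex vs R G) μ⟩,
          ⟨true, relGround R (skolemGround s p vs R G μ)⟩]
  | exSub {p : List ℕ} {vs : Finset V} {R : Atom L (V ⊕ L.Constants)} {G : RQFO L V}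
      (h : F.subAt p = some (.ex vs R G)) (μ : V → GTerm L V) :
      GroundClause s F .exSub
        [⟨false, definerGround s p (.ex vs R G) μ⟩,
          ⟨true, definerGround s (p ++ [1]) G (skolemGround s p vs R G μ)⟩]

theorem IsClauseInstance.groundClause {F : RQFO L V} {form : ClauseForm} {c : List (GLit L V)}
    (h : IsClauseInstance s F form c) : GroundClause s F form c := by
  obtain ⟨d, hd, μ, rfl⟩ := h
  cases hd <;>
    simp only [List.map_cons, List.map_nil, Lit.map, definerAtom_subst, relAtom_subst,
      skRelAtom_subst, skDefinerAtom_subst] <;>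
    constructor <;> assumption

/-- A clause other than `unit` and `all` consists of a negative literal and positive ones. -/
theorem GroundClause.signs {F : RQFO L V} {form : ClauseForm} {c : List (GLit L V)}
    (h : GroundClause s F form c) (h1 : form ≠ .unit) (h2 : form ≠ .all) :
    ∃ l ls, c = l :: ls ∧ ∀ l' ∈ ls, l'.sign = true := by
  cases h <;> simp_all

end Ground

/-! ### Ground arguments of definitional forms and of branches -/

section Defs

variable {L : FirstOrder.Language.{u, v}} {V : Type x}

theorem Fml.mem_garg_bigAnd {t : GTerm L V} (Fs : List (Fml L V)) :
    t ∈ (Fml.bigAnd Fs).garg ↔ ∃ F ∈ Fs, t ∈ F.garg := by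
  induction Fs with
  | nil => simp [Fml.bigAnd, Fml.garg]
  | cons F Fs ih =>
    rw [show Fml.bigAnd (F :: Fs) = Fml.and F (Fml.bigAnd Fs) from rfl]
    simp only [Fml.garg, Set.mem_union, ih, List.mem_cons, exists_eq_or_imp]

theorem mem_garg_branchFml {s : Side} {B : List (Side × GLit L V)} {t : GTerm L V} :
    t ∈ (branchFml s B).garg ↔ ∃ l, (s, l) ∈ B ∧ t ∈ l.atom.parg := by
  have key : ∀ A : Atom (Ext L V) (GTerm L V),
      (Sum.inr t : V ⊕ GTerm L V) ∈ (A.map Sum.inr).parg ↔ t ∈ A.parg := by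
    intro A
    exact exists_congr fun i => Sum.inr_injective.eq_iff
  rw [branchFml, Fml.mem_garg_bigAnd]
  constructor
  · rintro ⟨F, hF, ht⟩
    obtain ⟨⟨s', l⟩, hl, rfl⟩ := List.mem_map.1 hF
    simp only [List.mem_filter, decide_eq_true_eq] at hl
    obtain ⟨hl, rfl⟩ := hl
    refine ⟨l, hl, ?_⟩
    by_cases h : l.sign = true
    · simp only [h, if_true] at ht
      exact (key _).1 ht
    · simp only [h, if_false, Bool.false_eq_true] at ht
      exact (key _).1 ht
  · rintro ⟨l, hl, ht⟩
    refine ⟨_, List.mem_map.2 ⟨(s, l), by simp [hl], rfl⟩, ?_⟩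
    by_cases h : l.sign = true
    · simp only [h, if_true]
      exact (key _).2 ht
    · simp only [h, if_false, Bool.false_eq_true]
      exact (key _).2 ht

theorem garg_relFml (R : Atom L (V ⊕ L.Constants)) :
    (relFml R).garg = constTerm '' {c | Sum.inr c ∈ R.parg} := by
  ext t
  constructor
  · rintro ⟨i, hi⟩
    change Sum.map id constTerm (R.args i) = _ at hi
    cases h : R.args i with
    | inl y => simp [h] at hi
    | inr c => exact ⟨c, ⟨i, h⟩, by simpa [h] using hi⟩
  · rintro ⟨c, ⟨i, hi⟩, rfl⟩
    exact ⟨i, by simp [Atom.map, Atom.inLang, hi]⟩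

theorem RQ.exists_subAt_of_mem_garg {T : Type*} {F : RQ L V T} {c : T} (h : c ∈ F.garg) :
    ∃ p vs R K, (F.subAt p = some (.all vs R K) ∨ F.subAt p = some (.ex vs R K)) ∧
      Sum.inr c ∈ R.parg := by
  induction F with
  | top => exact h.elim
  | bot => exact h.elim
  | and F G ihF ihG =>
    rcases h with h | h
    · obtain ⟨p, vs, R, K, h1, h2⟩ := ihF h
      exact ⟨1 :: p, vs, R, K, by simpa [subAt] using h1, h2⟩
    · obtain ⟨p, vs, R, K, h1, h2⟩ := ihG h
      exact ⟨2 :: p, vs, R, K, by simpa [subAt] using h1, h2⟩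
  | or F G ihF ihG =>
    rcases h with h | h
    · obtain ⟨p, vs, R, K, h1, h2⟩ := ihF h
      exact ⟨1 :: p, vs, R, K, by simpa [subAt] using h1, h2⟩
    · obtain ⟨p, vs, R, K, h1, h2⟩ := ihG h
      exact ⟨2 :: p, vs, R, K, by simpa [subAt] using h1, h2⟩
  | all vs R F ih =>
    rcases h with h | h
    · exact ⟨[], vs, R, F, by simp [subAt], h⟩
    · obtain ⟨p, vs, R, K, h1, h2⟩ := ih h
      exact ⟨1 :: p, vs, R, K, by simpa [subAt] using h1, h2⟩
  | ex vs R F ih =>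
    rcases h with h | h
    · exact ⟨[], vs, R, F, by simp [subAt], h⟩
    · obtain ⟨p, vs, R, K, h1, h2⟩ := ih h
      exact ⟨1 :: p, vs, R, K, by simpa [subAt] using h1, h2⟩

variable [LinearOrder V]

theorem garg_definerFml (s : Side) (p : List ℕ) (K : RQFO L V) : (definerFml s p K).garg = ∅ := by
  ext t
  simp only [Set.mem_empty_iff_false, iff_false]
  rintro ⟨i, hi⟩
  cases hi

/-- Definer atoms have only variables as arguments in the definitional form; what remains are the
constants of the relativizing atoms. -/
theorem garg_defForm (s : Side) (F : RQFO L V) : (defForm s F).garg = constTerm '' F.garg := by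
  ext t
  simp only [defForm, Fml.garg, garg_definerFml, Set.empty_union, Fml.mem_garg_bigAnd,
    List.mem_filterMap, Option.map_eq_some_iff]
  constructor
  · rintro ⟨_, ⟨p, -, K, hK, rfl⟩, ht⟩
    refine Set.image_mono (RQ.garg_subset_of_subAt hK) ?_
    cases K <;>
      simp only [defImp, Fml.imp, Fml.garg, garg_definerFml, garg_relFml, Set.union_empty,
        Set.empty_union, Set.mem_empty_iff_false] at ht
    all_goals
      obtain ⟨c, hc, rfl⟩ := ht
      exact ⟨c, Or.inl hc, rfl⟩
  · rintro ⟨c, hc, rfl⟩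
    obtain ⟨p, vs, R, K, hK | hK, hR⟩ := RQ.exists_subAt_of_mem_garg hc
    all_goals
      refine ⟨_, ⟨p, RQ.mem_poss_of_subAt hK, _, hK, rfl⟩, ?_⟩
      simp only [defImp, Fml.imp, Fml.garg, garg_definerFml, garg_relFml, Set.union_empty,
        Set.empty_union]
      exact ⟨c, hR, rfl⟩

/-- The ground arguments of the definitional form and of the branch labels of a side. -/
def sideGarg (F G : RQFO L V) (s : Side) (B : List (Side × GLit L V)) : Set (GTerm L V) :=
  (Fml.and (defForm s (sideFml F G s)) (branchFml s B)).garg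

theorem mem_sideGarg {F G : RQFO L V} {s : Side} {B : List (Side × GLit L V)} {t : GTerm L V} :
    t ∈ sideGarg F G s B ↔ (∃ c ∈ (sideFml F G s).garg, t = constTerm c) ∨
      ∃ l, (s, l) ∈ B ∧ t ∈ l.atom.parg := by
  rw [sideGarg, Fml.garg, Set.mem_union, garg_defForm, mem_garg_branchFml]
  simp [eq_comm]

theorem sideGarg_cons_self {F G : RQFO L V} {s : Side} {B : List (Side × GLit L V)}
    {l : GLit L V} : sideGarg F G s ((s, l) :: B) = sideGarg F G s B ∪ l.atom.parg := by
  ext t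
  simp only [mem_sideGarg, Set.mem_union, List.mem_cons, Prod.mk.injEq, true_and, or_and_right,
    exists_or, exists_eq_left]
  exact (or_congr_right or_comm).trans or_assoc.symm

theorem sideGarg_cons_of_ne {F G : RQFO L V} {s s' : Side} (h : s' ≠ s)
    {B : List (Side × GLit L V)} {l : GLit L V} :
    sideGarg F G s' ((s, l) :: B) = sideGarg F G s' B := by
  ext t
  simp [mem_sideGarg, h]

end Defs

/-! ### Labels on the branches of a tableau -/

section Tableau

variable {L : FirstOrder.Language.{u, v}} {V : Type x}

theorem Tab.NodeAt.tail {Λ : Type*} {T N : Tab Λ} {s : Side} {l : Λ} {B : List (Side × Λ)}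
    (h : T.NodeAt ((s, l) :: B) N) : ∃ k lit sub, ∃ i : Fin k,
      T.NodeAt B (.inner s k lit sub) ∧ l = lit i := by
  cases h with
  | child h i => exact ⟨_, _, _, i, h, rfl⟩

/-- Each label on the branch of an inner node is the label of an inner node, so the leaf-only
condition applies to it. -/
theorem sign_of_mem_branch {T : GTab L V} (hT : IsLeafOnlyNegative T)
    {B : List (Side × GLit L V)} {N : GTab L V} (h : T.NodeAt B N) {s : Side} {k : ℕ}
    {lit : Fin k → GLit L V} {sub : Fin k → GTab L V} (hN : N = .inner s k lit sub)
    {s' : Side} {l : GLit L V} (hl : (s', l) ∈ B) : l.sign = true := by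
  induction h generalizing s k lit sub with
  | root => simp at hl
  | child h i ih =>
    rcases List.mem_cons.1 hl with hl | hl
    · obtain ⟨rfl, rfl⟩ := Prod.mk.inj hl
      exact hT _ _ _ _ _ _ _ (hN ▸ h.child i)
    · exact ih rfl hl

variable [LinearOrder V] {F G : RQFO L V} {T : GTab L V}

/-- A negative child is a leaf by the leaf-only condition, and leaves are closed. -/
theorem IsACITableau.compl_mem (hT : IsACITableau F G T) {B : List (Side × GLit L V)} {s : Side}
    {k : ℕ} {lit : Fin k → GLit L V} {sub : Fin k → GTab L V}
    (h : T.NodeAt B (.inner s k lit sub)) {l : GLit L V} (hl : l ∈ List.ofFn lit)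
    (hs : l.sign = false) : ∃ s', (s', l.compl) ∈ B := by
  obtain ⟨i, rfl⟩ := (List.mem_ofFn' _ _).1 hl
  have hc := h.child i
  cases hsub : sub i with
  | leaf =>
    obtain ⟨s₀, l₀, B', hB, h'⟩ := hT.closed _ (hsub ▸ hc)
    cases hB
    exact h'
  | inner s' k' lit' sub' =>
    rw [hsub] at hc
    have := hT.leafOnly _ _ _ _ _ _ _ hc
    simp [hs] at this

/-- A positive leaf could be closed only by a negative ancestor, but all labels above it are
positive. -/
theorem IsACITableau.ne_leaf (hT : IsACITableau F G T) {B : List (Side × GLit L V)} {s : Side}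
    {k : ℕ} {lit : Fin k → GLit L V} {sub : Fin k → GTab L V}
    (h : T.NodeAt B (.inner s k lit sub)) (i : Fin k) (hs : (lit i).sign = true) :
    sub i ≠ .leaf := by
  intro hsub
  obtain ⟨s₀, l₀, B', hB, s', h'⟩ := hT.closed _ (hsub ▸ h.child i)
  cases hB
  have := sign_of_mem_branch hT.leafOnly h rfl h'
  simp [Lit.compl, hs] at this

theorem IsACITableau.groundClause (hT : IsACITableau F G T) {B : List (Side × GLit L V)} {s : Side}
    {k : ℕ} {lit : Fin k → GLit L V} {sub : Fin k → GTab L V}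
    (h : T.NodeAt B (.inner s k lit sub)) :
    ∃ form, GroundClause s (sideFml F G s) form (List.ofFn lit) :=
  (hT.tableau _ _ _ _ _ h).imp fun _ => IsClauseInstance.groundClause

/-- A positive label of side `s` is a definer atom of side `s`, or its predicate occurs positively
in the formula of side `s`. -/
theorem IsACITableau.head_of_mem (hT : IsACITableau F G T) {B : List (Side × GLit L V)}
    {N : GTab L V} (h : T.NodeAt B N) {s : Side} {l : GLit L V} (hl : (s, l) ∈ B)
    (hs : l.sign = true) : (∃ p, l.atom.head = Sum.inr (s, p)) ∨
      ∃ P, l.atom.head = Sum.inl P ∧ (true, P) ∈ (sideFml F G s).pred := by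
  induction h with
  | root => simp at hl
  | @child B s' k lit sub h i ih =>
    rcases List.mem_cons.1 hl with hl | hl
    · obtain ⟨rfl, rfl⟩ := Prod.mk.inj hl
      obtain ⟨form, hc⟩ := hT.groundClause h
      have hi : lit i ∈ List.ofFn lit := (List.mem_ofFn' _ _).2 ⟨i, rfl⟩
      generalize lit i = l at *
      generalize List.ofFn lit = c at *
      cases hc with
      | exRel hp μ =>
        simp only [List.mem_cons, List.not_mem_nil, or_false] at hi
        rcases hi with rfl | rfl
        · simp at hs
        · exact Or.inr ⟨_, rfl, RQ.pred_subset_of_subAt hp (Or.inl rfl)⟩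
      | _ =>
        left
        simp only [List.mem_cons, List.not_mem_nil, or_false] at hi
        rcases hi with rfl | rfl | rfl <;> first | exact ⟨_, rfl⟩ | simp at hs
    · exact ih hl

/-- The definer predicates of the two sides are disjoint, and they differ from the predicates of
`L`. -/
theorem IsACITableau.side_eq_of_definer_mem (hT : IsACITableau F G T)
    {B : List (Side × GLit L V)} {N : GTab L V} (h : T.NodeAt B N) {s s' : Side} {p : List ℕ}
    {K : RQFO L V} {ν : V → GTerm L V} (hl : (s', ⟨true, definerGround s p K ν⟩) ∈ B) :
    s' = s := by
  rcases hT.head_of_mem h hl rfl with ⟨q, hq⟩ | ⟨P, hP, -⟩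
  · have : (Sum.inr (s, p) : (Σ n, L.Relations n) ⊕ (Side × List ℕ)) = Sum.inr (s', q) := hq
    simp only [Sum.inr.injEq, Prod.mk.injEq] at this
    exact this.1.symm
  · have : (Sum.inr (s, p) : (Σ n, L.Relations n) ⊕ (Side × List ℕ)) = Sum.inl P := hP
    cases this

/-- This makes the premise `D_p` of a clause available: it stands on the branch with the side of the
clause, where `BranchHolds` asserts its truth. -/
theorem IsACITableau.definer_mem (hT : IsACITableau F G T)
    {B : List (Side × GLit L V)} {s : Side} {k : ℕ} {lit : Fin k → GLit L V}
    {sub : Fin k → GTab L V} (h : T.NodeAt B (.inner s k lit sub)) {p : List ℕ}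
    {K : RQFO L V} {ν : V → GTerm L V} (hl : ⟨false, definerGround s p K ν⟩ ∈ List.ofFn lit) :
    (s, ⟨true, definerGround s p K ν⟩) ∈ B := by
  obtain ⟨s', h'⟩ := hT.compl_mem h hl rfl
  obtain rfl := hT.side_eq_of_definer_mem h h'
  exact h'

end Tableau

/-! ### Arguments of the literals of a clause -/

section Arguments

variable {L : FirstOrder.Language.{u, v}} {V : Type x} [LinearOrder V] {s : Side} {p : List ℕ}
  {vs : Finset V} {R : Atom L (V ⊕ L.Constants)} {K : RQFO L V} {μ : V → GTerm L V}

theorem mem_parg_definerGround_skolemGround {q : List ℕ} {t : GTerm L V}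
    (h : t ∈ (definerGround s q K (skolemGround s p vs R K μ)).parg) :
    (∃ y ∈ vs, t = skolemGround s p vs R K μ y) ∨
      t ∈ (definerGround s p (.ex vs R K) μ).parg := by
  obtain ⟨y, hy, rfl⟩ := mem_parg_definerGround.1 h
  by_cases hv : y ∈ vs
  · exact Or.inl ⟨y, hv, rfl⟩
  · rw [skolemGround_of_notMem hv]
    exact Or.inr (mem_parg_definerGround.2 ⟨y, by simp [RQ.fv, hy, hv], rfl⟩)

theorem mem_parg_relGround_skolemGround {t : GTerm L V}
    (h : t ∈ (relGround R (skolemGround s p vs R K μ)).parg) :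
    (∃ y ∈ vs, t = skolemGround s p vs R K μ y) ∨
      t ∈ (definerGround s p (.ex vs R K) μ).parg ∨ ∃ c, Sum.inr c ∈ R.parg ∧ t = constTerm c := by
  rcases mem_parg_relGround.1 h with ⟨y, hy, rfl⟩ | h
  · by_cases hv : y ∈ vs
    · exact Or.inl ⟨y, hv, rfl⟩
    · rw [skolemGround_of_notMem hv]
      exact Or.inr (Or.inl (mem_parg_definerGround.2
        ⟨y, by simp [RQ.fv, RQ.mem_atomVars.2 hy, hv], rfl⟩))
  · exact Or.inr (Or.inr h)

/-- Relativization enters here: since every quantified variable occurs in `R`, a universal clause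
brings no terms of its own into the branch. -/
theorem mem_parg_definerGround_all (hR : (.all vs R K : RQFO L V).Relativized) {q : List ℕ}
    {t : GTerm L V} (h : t ∈ (definerGround s q K μ).parg) :
    t ∈ (definerGround s p (.all vs R K) μ).parg ∨ t ∈ (relGround R μ).parg := by
  obtain ⟨y, hy, rfl⟩ := mem_parg_definerGround.1 h
  by_cases hv : y ∈ vs
  · exact Or.inr (mem_parg_relGround.2 (Or.inl ⟨y, hR.1 y hv, rfl⟩))
  · exact Or.inl (mem_parg_definerGround.2 ⟨y, by simp [RQ.fv, hy, hv], rfl⟩)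

theorem parg_definerGround_mono {q : List ℕ} {K' : RQFO L V} (h : K'.fv ⊆ K.fv) :
    (definerGround s q K' μ).parg ⊆ (definerGround s p K μ).parg := by
  intro t ht
  obtain ⟨y, hy, rfl⟩ := mem_parg_definerGround.1 ht
  exact mem_parg_definerGround.2 ⟨y, h hy, rfl⟩

/-- The two literals whose Skolem terms stem from the same instance of an existential
subformula. -/
def IsSkolemPair (s : Side) (p : List ℕ) (vs : Finset V) (R : Atom L (V ⊕ L.Constants))
    (K : RQFO L V) (μ : V → GTerm L V) (l : GLit L V) : Prop :=
  l = ⟨true, relGround R (skolemGround s p vs R K μ)⟩ ∨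
    l = ⟨true, definerGround s (p ++ [1]) K (skolemGround s p vs R K μ)⟩

/-- Both literals, with their Skolem terms, depend on `μ` only through the free variables of the
existential formula. -/
theorem isSkolemPair_congr {μ' : V → GTerm L V}
    (h : (sortedVars (.ex vs R K : RQFO L V)).map μ = (sortedVars (.ex vs R K : RQFO L V)).map μ')
    {l : GLit L V} (hl : IsSkolemPair s p vs R K μ l) : IsSkolemPair s p vs R K μ' l := by
  have h' : ∀ y ∈ (.ex vs R K : RQFO L V).fv, μ y = μ' y := fun y hy =>
    List.map_inj_left.1 h y (mem_sortedVars.2 hy)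
  have key : ∀ y, y ∈ RQ.atomVars R ∪ K.fv →
      skolemGround s p vs R K μ y = skolemGround s p vs R K μ' y := by
    intro y hy
    by_cases hv : y ∈ vs
    · rw [skolemGround_of_mem hv, skolemGround_of_mem hv]
      congr 1
      funext i
      exact h' _ (mem_sortedVars.1 (List.get_mem _ _))
    · rw [skolemGround_of_notMem hv, skolemGround_of_notMem hv]
      exact h' y (Finset.mem_sdiff.2 ⟨hy, hv⟩)
  unfold IsSkolemPair at *
  rwa [← relGround_congr fun y hy => key y (Finset.mem_union_left _ hy),
    ← definerGround_congr fun y hy => key y (Finset.mem_union_right _ hy)]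

end Arguments

/-! ### Occurrences of Skolem terms on branches -/

section Freshness

variable {L : FirstOrder.Language.{u, v}} {V : Type x} [LinearOrder V] {F G : RQFO L V}
  {T : GTab L V}

/-- An argument of a label is an argument of an ancestor, a constant, or a Skolem term that stems
from the clause of the label. -/
theorem IsACITableau.arg_origin (hT : IsACITableau F G T)
    (hs : ∀ s, (sideFml F G s).IsSentence) {B : List (Side × GLit L V)} {s : Side}
    {k : ℕ} {lit : Fin k → GLit L V} {sub : Fin k → GTab L V}
    (h : T.NodeAt B (.inner s k lit sub)) {l : GLit L V} (hl : l ∈ List.ofFn lit) {t : GTerm L V}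
    (ht : t ∈ l.atom.parg) :
    (∃ s' l', (s', l') ∈ B ∧ t ∈ l'.atom.parg) ∨ (∃ c, t = constTerm c) ∨
      ∃ p vs R K μ, (sideFml F G s).subAt p = some (.ex vs R K) ∧ IsSkolemPair s p vs R K μ l ∧
        ∃ y ∈ vs, t = skolemGround s p vs R K μ y := by
  cases hsign : l.sign with
  | false =>
    obtain ⟨s', h'⟩ := hT.compl_mem h hl hsign
    exact Or.inl ⟨s', _, h', ht⟩
  | true =>
    obtain ⟨form, hc⟩ := hT.groundClause h
    have hneg : ∀ {A}, (⟨false, A⟩ : GLit L V) ∈ List.ofFn lit →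
        t ∈ A.parg → ∃ s' l', (s', l') ∈ B ∧ t ∈ l'.atom.parg := by
      intro A hm ht
      obtain ⟨s', h'⟩ := hT.compl_mem h hm rfl
      exact ⟨s', _, h', ht⟩
    generalize List.ofFn lit = c at *
    cases hc with
    | unit μ =>
      simp only [List.mem_cons, List.not_mem_nil, or_false] at hl
      subst hl
      obtain ⟨y, hy, -⟩ := mem_parg_definerGround.1 ht
      simp [(hs s).2] at hy
    | bot hp μ =>
      simp only [List.mem_cons, List.not_mem_nil, or_false] at hl
      subst hl
      simp at hsign
    | andLeft hp μ =>
      simp only [List.mem_cons, List.not_mem_nil, or_false] at hl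
      rcases hl with rfl | rfl
      · simp at hsign
      · exact Or.inl (hneg List.mem_cons_self (parg_definerGround_mono Finset.subset_union_left ht))
    | andRight hp μ =>
      simp only [List.mem_cons, List.not_mem_nil, or_false] at hl
      rcases hl with rfl | rfl
      · simp at hsign
      · exact Or.inl (hneg List.mem_cons_self (parg_definerGround_mono Finset.subset_union_right ht))
    | or hp μ =>
      simp only [List.mem_cons, List.not_mem_nil, or_false] at hl
      rcases hl with rfl | rfl | rfl
      · simp at hsign
      · exact Or.inl (hneg List.mem_cons_self (parg_definerGround_mono Finset.subset_union_left ht))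
      · exact Or.inl (hneg List.mem_cons_self (parg_definerGround_mono Finset.subset_union_right ht))
    | @all p vs R K hp μ =>
      simp only [List.mem_cons, List.not_mem_nil, or_false] at hl
      rcases hl with rfl | rfl | rfl
      · simp at hsign
      · simp at hsign
      · rcases mem_parg_definerGround_all (p := p)
          (RQ.relativized_of_subAt hp (hs s).1) ht with ht | ht
        · exact Or.inl (hneg (by simp) ht)
        · exact Or.inl (hneg (by simp) ht)
    | exRel hp μ =>
      simp only [List.mem_cons, List.not_mem_nil, or_false] at hl
      rcases hl with rfl | rfl
      · simp at hsign
      · rcases mem_parg_relGround_skolemGround ht with hy | ht | ⟨c, hc, rfl⟩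
        · exact Or.inr (Or.inr ⟨_, _, _, _, μ, hp, Or.inl rfl, hy⟩)
        · exact Or.inl (hneg (by simp) ht)
        · exact Or.inr (Or.inl ⟨c, rfl⟩)
    | exSub hp μ =>
      simp only [List.mem_cons, List.not_mem_nil, or_false] at hl
      rcases hl with rfl | rfl
      · simp at hsign
      · rcases mem_parg_definerGround_skolemGround ht with hy | ht
        · exact Or.inr (Or.inr ⟨_, _, _, _, μ, hp, Or.inr rfl, hy⟩)
        · exact Or.inl (hneg (by simp) ht)

variable {s : Side} {p : List ℕ} {vs : Finset V} {R : Atom L (V ⊕ L.Constants)} {K : RQFO L V}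
  {μ : V → GTerm L V}

/-- If a Skolem term is an argument of a label but of no ancestor, then the label has the side of
the Skolem term and belongs to its Skolem pair. -/
theorem IsACITableau.isSkolemPair_of_fresh (hT : IsACITableau F G T)
    (hs : ∀ s, (sideFml F G s).IsSentence) (hp : (sideFml F G s).subAt p = some (.ex vs R K))
    {B : List (Side × GLit L V)} {s' : Side}
    {k : ℕ} {lit : Fin k → GLit L V} {sub : Fin k → GTab L V}
    (h : T.NodeAt B (.inner s' k lit sub)) {l : GLit L V} (hl : l ∈ List.ofFn lit)
    {y : V} (hy : y ∈ vs) (ht : skolemGround s p vs R K μ y ∈ l.atom.parg)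
    (hB : ∀ s₁ l₁, (s₁, l₁) ∈ B → skolemGround s p vs R K μ y ∉ l₁.atom.parg) :
    s' = s ∧ IsSkolemPair s p vs R K μ l := by
  rcases hT.arg_origin hs h hl ht with ⟨s₁, l₁, h1, h2⟩ | ⟨c, hc⟩ |
      ⟨p', vs', R', K', μ', hp', hl', y', hy', heq⟩
  · exact (hB s₁ l₁ h1 h2).elim
  · exact (skolemGround_ne_constTerm hy c hc).elim
  · obtain ⟨rfl, rfl, rfl, hμ⟩ := skolemGround_inj hy hy' heq
    rw [hp, Option.some.injEq] at hp'
    cases hp'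
    exact ⟨rfl, isSkolemPair_congr hμ.symm hl'⟩

/-- Going down the branch, the first label with the Skolem term would have to belong to the Skolem
pair. -/
theorem IsACITableau.skolem_fresh (hT : IsACITableau F G T)
    (hs : ∀ s, (sideFml F G s).IsSentence) (hp : (sideFml F G s).subAt p = some (.ex vs R K))
    {B : List (Side × GLit L V)} {N : GTab L V} (h : T.NodeAt B N)
    (hB : ∀ s₁ l₁, (s₁, l₁) ∈ B → ¬ IsSkolemPair s p vs R K μ l₁) {y : V} (hy : y ∈ vs) :
    ∀ s₁ l₁, (s₁, l₁) ∈ B → skolemGround s p vs R K μ y ∉ l₁.atom.parg := by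
  induction h with
  | root => simp
  | @child B s' k lit sub h i ih =>
    have ih' := ih fun s₁ l₁ h₁ => hB s₁ l₁ (List.mem_cons_of_mem _ h₁)
    intro s₁ l₁ h₁ ht
    rcases List.mem_cons.1 h₁ with h₁ | h₁
    · obtain ⟨rfl, rfl⟩ := Prod.mk.inj h₁
      exact hB _ _ (List.mem_cons_self ..) (hT.isSkolemPair_of_fresh hs hp h
        ((List.mem_ofFn' _ _).2 ⟨i, rfl⟩) hy ht ih').2
    · exact ih' s₁ l₁ h₁ ht

/-- Two labels of a Skolem pair on a branch are adjacent. -/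
theorem IsACITableau.isSkolemPair_adjacent (hT : IsACITableau F G T)
    (hp : (sideFml F G s).subAt p = some (.ex vs R K)) {B : List (Side × GLit L V)} {N : GTab L V}
    {s₀ s₁ : Side} {l₀ l₁ : GLit L V} (h : T.NodeAt ((s₀, l₀) :: B) N)
    (h₀ : IsSkolemPair s p vs R K μ l₀) (h₁ : IsSkolemPair s p vs R K μ l₁) (hl₁ : (s₁, l₁) ∈ B) :
    ∃ B', B = (s₁, l₁) :: B' := by
  obtain ⟨j, hj⟩ := List.mem_iff_getElem?.1 hl₁
  have hj' : ((s₀, l₀) :: B)[j + 1]? = some (s₁, l₁) := by simpa using hj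
  have hcont := hT.contiguous s p vs R K hp μ
  rw [skRelAtom_subst, skDefinerAtom_subst] at hcont
  -- Two equal literals contradict regularity; the two different ones are neighbours by contiguity.
  -- Index `0` of the extended branch is `l₀`, so index `j + 1` must be `1`.
  have hj0 : j = 0 := by
    rcases h₀ with rfl | rfl <;> rcases h₁ with rfl | rfl
    · exact (hT.regular _ _ _ _ h _ hl₁).elim
    · have := hcont _ _ h 0 (j + 1) s₀ s₁ rfl hj'
      omega
    · have := hcont _ _ h (j + 1) 0 s₁ s₀ hj' rfl
      omega
    · exact (hT.regular _ _ _ _ h _ hl₁).elim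
  subst hj0
  cases B with
  | nil => simp at hl₁
  | cons b B' => exact ⟨B', by simpa using hj⟩

/-- Above a label of a Skolem pair, the Skolem terms occur at most in the other label of the
pair. -/
theorem IsACITableau.skolem_occurrence (hT : IsACITableau F G T)
    (hs : ∀ s, (sideFml F G s).IsSentence) (hp : (sideFml F G s).subAt p = some (.ex vs R K))
    {B : List (Side × GLit L V)} {N : GTab L V} {s₀ : Side} {l₀ : GLit L V}
    (h : T.NodeAt ((s₀, l₀) :: B) N) (h₀ : IsSkolemPair s p vs R K μ l₀) {y : V} (hy : y ∈ vs)
    {s₁ : Side} {l₁ : GLit L V} (h₁ : (s₁, l₁) ∈ B)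
    (ht : skolemGround s p vs R K μ y ∈ l₁.atom.parg) :
    s₁ = s ∧ IsSkolemPair s p vs R K μ l₁ := by
  obtain ⟨k, lit, sub, i, hB, rfl⟩ := h.tail
  by_cases hpair : ∃ s₂ l₂, (s₂, l₂) ∈ B ∧ IsSkolemPair s p vs R K μ l₂
  · obtain ⟨s₂, l₂, hl₂, hp₂⟩ := hpair
    obtain ⟨B', rfl⟩ := hT.isSkolemPair_adjacent hp h h₀ hp₂ hl₂
    obtain ⟨k', lit', sub', i', hB', rfl⟩ := hB.tail
    -- The pair label in `B` is the parent. A further one above it would, again by adjacency to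
    -- `l₀`, be the literal of the parent, against regularity.
    have hne : ∀ s' l', (s', l') ∈ B' → ¬ IsSkolemPair s p vs R K μ l' := by
      intro s' l' hl' hpl'
      obtain ⟨B'', hB''⟩ := hT.isSkolemPair_adjacent hp h h₀ hpl' (List.mem_cons_of_mem _ hl')
      cases hB''
      exact hT.regular _ _ _ _ hB _ hl'
    have hfresh := hT.skolem_fresh hs hp hB' hne hy
    rcases List.mem_cons.1 h₁ with h₁ | h₁
    · obtain ⟨rfl, rfl⟩ := Prod.mk.inj h₁
      exact hT.isSkolemPair_of_fresh hs hp hB' ((List.mem_ofFn' _ _).2 ⟨i', rfl⟩) hy ht hfresh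
    · exact (hfresh _ _ h₁ ht).elim
  · push Not at hpair
    exact (hT.skolem_fresh hs hp hB hpair hy _ _ h₁ ht).elim

/-- Any occurrence above is in the partner literal, which has side `s`. New values for the Skolem
terms hence do not affect the other side. -/
theorem IsACITableau.skolem_notMem_sideGarg (hT : IsACITableau F G T)
    (hs : ∀ s, (sideFml F G s).IsSentence) (hp : (sideFml F G s).subAt p = some (.ex vs R K))
    {B : List (Side × GLit L V)} {N : GTab L V} {s₀ : Side} {l₀ : GLit L V}
    (h : T.NodeAt ((s₀, l₀) :: B) N) (h₀ : IsSkolemPair s p vs R K μ l₀) {y : V} (hy : y ∈ vs)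
    {s' : Side} (hs' : s' ≠ s) : skolemGround s p vs R K μ y ∉ sideGarg F G s' B := by
  intro hmem
  rcases mem_sideGarg.1 hmem with ⟨c, -, hc⟩ | ⟨l, hl, ht⟩
  · exact skolemGround_ne_constTerm hy c hc
  · exact hs' (hT.skolem_occurrence hs hp h h₀ hy hl ht).1

end Freshness

/-! ### Truth of branches under independent values of the ground terms -/

section Semantics

variable {L : FirstOrder.Language.{u, v}} {V : Type x} [LinearOrder V] {F G : RQFO L V}
  {M : Type w} [L.Structure M] {e e' : GTerm L V → M}

/-- Truth of an atom of the extended language, where `e` interprets the ground terms and a definer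
predicate is interpreted by the subformula that it defines. -/
def ExtHolds (F G : RQFO L V) (e : GTerm L V → M) (A : Atom (Ext L V) (GTerm L V)) : Prop :=
  Sum.elim (fun r : L.Relations A.arity => Structure.RelMap r fun i => e (A.args i))
    (fun q : Side × List ℕ => ∃ K a, (sideFml F G q.1).subAt q.2 = some K ∧
      (List.ofFn fun i => e (A.args i)) = (sortedVars K).map a ∧
        K.Sat (fun c : L.Constants => (c : M)) a) A.rel

theorem extHolds_congr {A : Atom (Ext L V) (GTerm L V)} (h : ∀ t ∈ A.parg, e t = e' t) :
    ExtHolds F G e A ↔ ExtHolds F G e' A := by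
  have : (fun i => e (A.args i)) = fun i => e' (A.args i) := funext fun i => h _ ⟨i, rfl⟩
  simp only [ExtHolds, this]

theorem extHolds_inLang (R : Atom L (GTerm L V)) :
    ExtHolds F G e (R.inLang LHom.sumInl) ↔ (R.map e).Holds := Iff.rfl

theorem extHolds_relGround {R : Atom L (V ⊕ L.Constants)} {ν : V → GTerm L V} {b : V → M}
    (hb : ∀ y ∈ RQ.atomVars R, e (ν y) = b y)
    (hc : ∀ c : L.Constants, Sum.inr c ∈ R.parg → e (constTerm c) = (c : M)) :
    ExtHolds F G e (relGround R ν) ↔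
      (R.map (Sum.elim b fun c : L.Constants => (c : M))).Holds := by
  rw [relGround_eq_inLang, extHolds_inLang]
  apply RQ.atom_holds_congr
  intro i
  cases hi : R.args i with
  | inl y => exact hb y (RQ.mem_atomVars.2 ⟨i, hi⟩)
  | inr c => exact hc c ⟨i, hi⟩

/-- The arguments of the definer list the values of all free variables of `K`, so the valuation
chosen in `ExtHolds` is irrelevant. -/
theorem extHolds_definerGround {s : Side} {p : List ℕ} {K : RQFO L V} {ν : V → GTerm L V}
    {b : V → M} (hp : (sideFml F G s).subAt p = some K) (hb : ∀ y ∈ K.fv, e (ν y) = b y) :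
    ExtHolds F G e (definerGround s p K ν) ↔ K.Sat (fun c : L.Constants => (c : M)) b := by
  have hlist : (List.ofFn fun i => e ((definerGround s p K ν).args i)) = (sortedVars K).map b := by
    rw [← List.ofFn_getElem_eq_map]
    exact congrArg _ (funext fun i => hb _ (mem_sortedVars.1 (List.get_mem _ _)))
  change (∃ K' a, (sideFml F G s).subAt p = some K' ∧
      (List.ofFn fun i => e ((definerGround s p K ν).args i)) = (sortedVars K').map a ∧
        K'.Sat (fun c : L.Constants => (c : M)) a) ↔ _
  rw [hlist]
  constructor
  · rintro ⟨K', a, hK', ha, hsat⟩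
    rw [hp, Option.some.injEq] at hK'
    subst hK'
    exact (K.sat_congr (fun y hy => List.map_inj_left.1 ha y (mem_sortedVars.2 hy))
      fun _ _ => rfl).2 hsat
  · exact fun h => ⟨K, b, hp, rfl, h⟩

/-- The formula of side `s` is true, its constants are interpreted as in the structure, and the
labels of side `s` on the branch are true. -/
structure BranchHolds (F G : RQFO L V) (s : Side) (e : GTerm L V → M)
    (B : List (Side × GLit L V)) : Prop where
  sat : ∀ a, (sideFml F G s).Sat (fun c : L.Constants => (c : M)) a
  const : ∀ c ∈ (sideFml F G s).garg, e (constTerm c) = (c : M)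
  labels : ∀ l, (s, l) ∈ B → ExtHolds F G e l.atom

theorem BranchHolds.cons {s : Side} {B : List (Side × GLit L V)} (h : BranchHolds F G s e B)
    {l : GLit L V} (hl : ExtHolds F G e l.atom) : BranchHolds F G s e ((s, l) :: B) := by
  refine ⟨h.sat, h.const, fun l' hl' => ?_⟩
  rcases List.mem_cons.1 hl' with hl' | hl'
  · obtain ⟨-, rfl⟩ := Prod.mk.inj hl'
    exact hl
  · exact h.labels l' hl'

theorem BranchHolds.cons_of_ne {s s' : Side} {B : List (Side × GLit L V)}
    (h : BranchHolds F G s' e B) (hs : s' ≠ s) {l : GLit L V} :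
    BranchHolds F G s' e ((s, l) :: B) :=
  ⟨h.sat, h.const, fun l' hl' => h.labels l' (by simpa [hs] using hl')⟩

/-- The formula of the side is evaluated without `e`; only its constants and the arguments of the
labels see the change. -/
theorem BranchHolds.congr {s : Side} {B : List (Side × GLit L V)} (h : BranchHolds F G s e B)
    (he : ∀ t ∈ sideGarg F G s B, e t = e' t) : BranchHolds F G s e' B := by
  refine ⟨h.sat, fun c hc => ?_, fun l hl => ?_⟩
  · rw [← he _ (mem_sideGarg.2 (Or.inl ⟨c, hc, rfl⟩)), h.const c hc]
  · exact (extHolds_congr fun t ht => he t (mem_sideGarg.2 (Or.inr ⟨l, hl, ht⟩))).1 (h.labels l hl)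

theorem BranchHolds.definer_sat {s : Side} {B : List (Side × GLit L V)}
    (h : BranchHolds F G s e B) {p : List ℕ} {K : RQFO L V} {ν : V → GTerm L V}
    (hp : (sideFml F G s).subAt p = some K) (hl : (s, ⟨true, definerGround s p K ν⟩) ∈ B) :
    K.Sat (fun c : L.Constants => (c : M)) (e ∘ ν) :=
  (extHolds_definerGround hp fun _ _ => rfl).1 (h.labels _ hl)

/-- The Skolem terms of a pair can be interpreted such that both literals of the pair hold. -/
theorem IsACITableau.branchHolds_skolem {T : GTab L V} (hT : IsACITableau F G T)
    (hs : ∀ s, (sideFml F G s).IsSentence) {s : Side} {p : List ℕ} {vs : Finset V}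
    {R : Atom L (V ⊕ L.Constants)} {K : RQFO L V} {μ : V → GTerm L V}
    (hp : (sideFml F G s).subAt p = some (.ex vs R K)) {B : List (Side × GLit L V)} {N : GTab L V}
    {l : GLit L V} (h : T.NodeAt ((s, l) :: B) N) (hl : IsSkolemPair s p vs R K μ l)
    (hD : (s, ⟨true, definerGround s p (.ex vs R K) μ⟩) ∈ B) (hB : BranchHolds F G s e B) :
    ∃ e' : GTerm L V → M, BranchHolds F G s e' ((s, l) :: B) ∧
      ∀ s' ≠ s, ∀ t ∈ sideGarg F G s' B, e' t = e t := by
  classical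
  -- Truth of `D_p` is truth of the existential formula at `e ∘ μ`. The witness `b` provides the new
  -- values of the Skolem terms.
  obtain ⟨b, hb, hbR, hbK⟩ := hB.definer_sat hp hD
  let e' : GTerm L V → M := fun t =>
    if h : ∃ y ∈ vs, t = skolemGround s p vs R K μ y then b h.choose else e t
  have he' : ∀ t, (∀ y ∈ vs, t ≠ skolemGround s p vs R K μ y) → e' t = e t := by
    intro t ht
    exact dif_neg fun ⟨y, hy, h⟩ => ht y hy h
  have hsk : ∀ y ∈ vs, e' (skolemGround s p vs R K μ y) = b y := by
    intro y hy
    have hex : ∃ z ∈ vs, skolemGround s p vs R K μ y = skolemGround s p vs R K μ z := ⟨y, hy, rfl⟩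
    -- The chosen variable can only be `y`, because Skolem terms for different variables differ.
    have := (skolemGround_inj hy hex.choose_spec.1 hex.choose_spec.2).2.2.1
    exact (dif_pos hex).trans (congrArg b this.symm)
  have hall : ∀ y ∈ RQ.atomVars R ∪ K.fv, e' (skolemGround s p vs R K μ y) = b y := by
    intro y hy
    by_cases hv : y ∈ vs
    · exact hsk y hv
    · rw [skolemGround_of_notMem hv, he', hb y hv]
      · rfl
      · exact fun z hz => skolemGround_ne_of_mem_fv hz (Finset.mem_sdiff.2 ⟨hy, hv⟩)
  have hconst : ∀ c, e' (constTerm c) = e (constTerm c) := fun c =>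
    he' _ fun y hy => (skolemGround_ne_constTerm hy c).symm
  -- Both literals of the pair become true at once, so a partner that is already on the branch
  -- survives the new values.
  have hpair : ∀ l', IsSkolemPair s p vs R K μ l' → ExtHolds F G e' l'.atom := by
    rintro l' (rfl | rfl)
    · refine (extHolds_relGround (fun y hy => hall y (Finset.mem_union_left _ hy)) ?_).2 hbR
      intro c hc
      rw [hconst, hB.const c (RQ.garg_subset_of_subAt hp (Or.inl hc))]
    · refine (extHolds_definerGround ?_ fun y hy => hall y (Finset.mem_union_right _ hy)).2 hbK
      simp [RQ.subAt_append hp, RQ.subAt]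
  refine ⟨e', BranchHolds.cons ⟨hB.sat, fun c hc => by rw [hconst, hB.const c hc], ?_⟩
    (hpair l hl), ?_⟩
  · intro l' hl'
    by_cases hx : ∃ y ∈ vs, skolemGround s p vs R K μ y ∈ l'.atom.parg
    · obtain ⟨y, hy, ht⟩ := hx
      exact hpair l' (hT.skolem_occurrence hs hp h hl hy hl' ht).2
    · refine (extHolds_congr fun t ht => (he' t ?_).symm).1 (hB.labels l' hl')
      rintro y hy rfl
      exact hx ⟨y, hy, ht⟩
  · intro s' hs' t ht
    refine he' t ?_
    rintro y hy rfl
    exact hT.skolem_notMem_sideGarg hs hp h hl hy hs' ht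

/-- If a branch holds at an inner node with a clause other than `unit` and `all`, then it holds,
up to the values of terms that are not arguments of the other side, for one of its extensions. -/
theorem IsACITableau.branchHolds_step {T : GTab L V} (hT : IsACITableau F G T)
    (hs : ∀ s, (sideFml F G s).IsSentence) {B : List (Side × GLit L V)} {s : Side}
    {k : ℕ} {lit : Fin k → GLit L V} {sub : Fin k → GTab L V} {form : ClauseForm}
    (h : T.NodeAt B (.inner s k lit sub)) (h1 : form ≠ .unit) (h2 : form ≠ .all)
    (hc : GroundClause s (sideFml F G s) form (List.ofFn lit)) (hB : BranchHolds F G s e B) :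
    ∃ l ∈ (List.ofFn lit).tail, ∃ e' : GTerm L V → M, BranchHolds F G s e' ((s, l) :: B) ∧
      ∀ s' ≠ s, ∀ t ∈ sideGarg F G s' B, e' t = e t := by
  have hD : ∀ {p K μ}, (⟨false, definerGround s p K μ⟩ : GLit L V) ∈ List.ofFn lit →
      (s, ⟨true, definerGround s p K μ⟩) ∈ B := fun hm => hT.definer_mem h hm
  have hchild : ∀ l ∈ List.ofFn lit, ∃ N, T.NodeAt ((s, l) :: B) N := by
    intro l hl
    obtain ⟨i, rfl⟩ := (List.mem_ofFn' _ _).1 hl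
    exact ⟨_, h.child i⟩
  -- For clauses without Skolem terms `e` itself serves; `q` leads from the subformula to its
  -- immediate subformula.
  have same : ∀ {p q K K' μ} {c : List (GLit L V)}, (sideFml F G s).subAt p = some K →
      K.subAt q = some K' →
      (∀ {b : V → M}, b = e ∘ μ → K'.Sat (fun c : L.Constants => (c : M)) b) →
      ⟨true, definerGround s (p ++ q) K' μ⟩ ∈ c →
      ∃ l ∈ c, ∃ e' : GTerm L V → M, BranchHolds F G s e' ((s, l) :: B) ∧
        ∀ s' ≠ s, ∀ t ∈ sideGarg F G s' B, e' t = e t := by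
    intro p q K K' μ c hp hq hsat hm
    refine ⟨_, hm, e, hB.cons ?_, fun _ _ _ _ => rfl⟩
    exact (extHolds_definerGround ((RQ.subAt_append hp q).trans hq) fun _ _ => rfl).2 (hsat rfl)
  generalize List.ofFn lit = c at *
  cases hc with
  | unit μ => exact (h1 rfl).elim
  | all hp μ => exact (h2 rfl).elim
  | bot hp μ => exact (hB.definer_sat hp (hD List.mem_cons_self)).elim
  | andLeft hp μ =>
    have := hB.definer_sat hp (hD List.mem_cons_self)
    exact same (q := [1]) hp (by simp [RQ.subAt]) (fun hb => hb ▸ this.1) (by simp)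
  | andRight hp μ =>
    have := hB.definer_sat hp (hD List.mem_cons_self)
    exact same (q := [2]) hp (by simp [RQ.subAt]) (fun hb => hb ▸ this.2) (by simp)
  | or hp μ =>
    rcases hB.definer_sat hp (hD List.mem_cons_self) with this | this
    · exact same (q := [1]) hp (by simp [RQ.subAt]) (fun hb => hb ▸ this) (by simp)
    · exact same (q := [2]) hp (by simp [RQ.subAt]) (fun hb => hb ▸ this) (by simp)
  | exRel hp μ =>
    obtain ⟨N, hN⟩ := hchild _ (List.mem_cons_of_mem _ List.mem_cons_self)
    exact ⟨_, List.mem_cons_self, hT.branchHolds_skolem hs hp hN (Or.inl rfl)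
      (hD List.mem_cons_self) hB⟩
  | exSub hp μ =>
    obtain ⟨N, hN⟩ := hchild _ (List.mem_cons_of_mem _ List.mem_cons_self)
    exact ⟨_, List.mem_cons_self, hT.branchHolds_skolem hs hp hN (Or.inr rfl)
      (hD List.mem_cons_self) hB⟩

/-- The arguments of the labels that extend a branch by a clause other than `unit` and `all` are
arguments of the side of the clause or not arguments of the other side. -/
theorem IsACITableau.args_step {T : GTab L V} (hT : IsACITableau F G T)
    (hs : ∀ s, (sideFml F G s).IsSentence) {B : List (Side × GLit L V)} {s : Side}
    {k : ℕ} {lit : Fin k → GLit L V} {sub : Fin k → GTab L V} {form : ClauseForm}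
    (h : T.NodeAt B (.inner s k lit sub)) (h1 : form ≠ .unit) (h2 : form ≠ .all)
    (hc : GroundClause s (sideFml F G s) form (List.ofFn lit)) {l : GLit L V}
    (hl : l ∈ (List.ofFn lit).tail) {t : GTerm L V} (ht : t ∈ l.atom.parg) :
    t ∈ sideGarg F G s B ∨ ∀ s' ≠ s, t ∉ sideGarg F G s' B := by
  have hD : ∀ {p K μ}, (⟨false, definerGround s p K μ⟩ : GLit L V) ∈ List.ofFn lit →
      t ∈ (definerGround s p K μ).parg → t ∈ sideGarg F G s B :=
    fun hm ht => mem_sideGarg.2 (Or.inr ⟨_, hT.definer_mem h hm, ht⟩)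
  have hchild : ∀ l ∈ List.ofFn lit, ∃ N, T.NodeAt ((s, l) :: B) N := by
    intro l hl
    obtain ⟨i, rfl⟩ := (List.mem_ofFn' _ _).1 hl
    exact ⟨_, h.child i⟩
  obtain ⟨N, hN⟩ := hchild l (List.mem_of_mem_tail hl)
  generalize List.ofFn lit = c at *
  cases hc with
  | unit μ => exact (h1 rfl).elim
  | all hp μ => exact (h2 rfl).elim
  | bot hp μ => simp at hl
  | andLeft hp μ =>
    simp only [List.tail_cons, List.mem_cons, List.not_mem_nil, or_false] at hl
    subst hl
    exact Or.inl (hD List.mem_cons_self (parg_definerGround_mono Finset.subset_union_left ht))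
  | andRight hp μ =>
    simp only [List.tail_cons, List.mem_cons, List.not_mem_nil, or_false] at hl
    subst hl
    exact Or.inl (hD List.mem_cons_self (parg_definerGround_mono Finset.subset_union_right ht))
  | or hp μ =>
    simp only [List.tail_cons, List.mem_cons, List.not_mem_nil, or_false] at hl
    rcases hl with rfl | rfl
    · exact Or.inl (hD List.mem_cons_self (parg_definerGround_mono Finset.subset_union_left ht))
    · exact Or.inl (hD List.mem_cons_self (parg_definerGround_mono Finset.subset_union_right ht))
  | exRel hp μ =>
    simp only [List.tail_cons, List.mem_cons, List.not_mem_nil, or_false] at hl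
    subst hl
    rcases mem_parg_relGround_skolemGround ht with ⟨y, hy, rfl⟩ | ht | ⟨c, hc, rfl⟩
    · exact Or.inr fun s' hs' => hT.skolem_notMem_sideGarg hs hp hN (Or.inl rfl) hy hs'
    · exact Or.inl (hD List.mem_cons_self ht)
    · exact Or.inl (mem_sideGarg.2 (Or.inl ⟨c, RQ.garg_subset_of_subAt hp (Or.inl hc), rfl⟩))
  | exSub hp μ =>
    simp only [List.tail_cons, List.mem_cons, List.not_mem_nil, or_false] at hl
    subst hl
    rcases mem_parg_definerGround_skolemGround ht with ⟨y, hy, rfl⟩ | ht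
    · exact Or.inr fun s' hs' => hT.skolem_notMem_sideGarg hs hp hN (Or.inr rfl) hy hs'
    · exact Or.inl (hD List.mem_cons_self ht)

end Semantics

/-! ### The invariant of extraction -/

section Invariant

variable {L : FirstOrder.Language.{u, v}} {V : Type x}

theorem Atom.inLang_injective {A : Type*} {R R' : Atom L A}
    (h : R.inLang (LHom.sumInl : L →ᴸ Ext L V) = R'.inLang LHom.sumInl) : R = R' := by
  obtain ⟨n, r, args⟩ := R
  obtain ⟨n', r', args'⟩ := R'
  simp only [Atom.inLang, Atom.mk.injEq] at h
  obtain ⟨rfl, h1, h2⟩ := h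
  rw [heq_eq_eq] at h1 h2
  rw [Sum.inl_injective h1, h2]

theorem parg_map_inr {R : Atom L (GTerm L V)} {t : GTerm L V} :
    (Sum.inr t : V ⊕ GTerm L V) ∈ (R.map Sum.inr).parg ↔ t ∈ R.parg :=
  exists_congr fun _ => Sum.inr_injective.eq_iff

open Classical in
theorem holds_map_invSubst {T : Type*} {M : Type*} [L.Structure M] {e e' : T → M} {ts : Set T}
    {θ : T → V} {b : V → M} (R : Atom L T) (h1 : ∀ t ∈ ts, e' t = b (θ t))
    (h2 : ∀ t, t ∉ ts → e' t = e t) :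
    (((R.map (Sum.inr : T → V ⊕ T)).map (Sum.elim Sum.inl fun t =>
      if t ∈ ts then Sum.inl (θ t) else Sum.inr t)).map (Sum.elim b e)).Holds ↔
      (R.map e').Holds := by
  apply RQ.atom_holds_congr
  intro i
  change Sum.elim b e (if R.args i ∈ ts then _ else _) = e' (R.args i)
  by_cases ht : R.args i ∈ ts
  · simp [ht, h1]
  · simp [ht, h2]

open Classical in
/-- An interpretation of the ground terms that is correct for the constants. -/
theorem exists_eval_constTerm (M : Type w) [Nonempty M] [L.Structure M] :
    ∃ e : GTerm L V → M, ∀ c : L.Constants, e (constTerm c) = (c : M) := by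
  refine ⟨fun t => if h : ∃ c : L.Constants, constTerm c = t then (h.choose : M)
    else Classical.arbitrary M, fun c => ?_⟩
  have hex : ∃ d : L.Constants, (constTerm d : GTerm L V) = constTerm c := ⟨c, rfl⟩
  exact (dif_pos hex).trans (congrArg (fun d : L.Constants => (d : M))
    (constTerm_injective hex.choose_spec))

variable [LinearOrder V] {F G : RQFO L V}

theorem GroundClause.exists_of_all {s : Side} {lit : Fin 3 → GLit L V}
    (h : GroundClause s F .all (List.ofFn lit)) :
    ∃ p vs R K, ∃ μ : V → GTerm L V, F.subAt p = some (.all vs R K) ∧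
      lit 0 = ⟨false, definerGround s p (.all vs R K) μ⟩ ∧ lit 1 = ⟨false, relGround R μ⟩ ∧
        lit 2 = ⟨true, definerGround s (p ++ [1]) K μ⟩ := by
  generalize hc : List.ofFn lit = c at h
  cases h with
  | @all p vs R K hp μ =>
    simp only [List.ofFn_succ, List.ofFn_zero, List.cons.injEq, and_true] at hc
    exact ⟨p, vs, R, K, μ, hp, hc.1, hc.2.1, hc.2.2⟩

/-- The conditions on access interpolants that concern single subformulas. -/
structure Admissible (F G : RQFO L V) (H : RQFOT L V) : Prop where
  relativized : H.Relativized
  fv : H.fv = ∅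
  pred : H.pred ⊆ F.pred ∩ G.pred
  existential : ∀ b ∈ H.bpatt, b.sign = true → ∃ b' ∈ G.bpatt, b.Covered b'
  universal : ∀ b ∈ H.bpatt, b.sign = false → ∃ b' ∈ F.bpatt, b.Covered b'

theorem Admissible.top : Admissible F G .top :=
  ⟨trivial, rfl, Set.empty_subset _, fun _ hb => hb.elim, fun _ hb => hb.elim⟩

theorem Admissible.bot : Admissible F G .bot :=
  ⟨trivial, rfl, Set.empty_subset _, fun _ hb => hb.elim, fun _ hb => hb.elim⟩

theorem Admissible.and (H K : RQFOT L V) (h : Admissible F G H) (h' : Admissible F G K) :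
    Admissible F G (.and H K) :=
  ⟨⟨h.1, h'.1⟩, by simp [RQ.fv, h.fv, h'.fv], Set.union_subset h.pred h'.pred,
    fun b hb => hb.elim (h.existential b) (h'.existential b),
    fun b hb => hb.elim (h.universal b) (h'.universal b)⟩

theorem Admissible.or (H K : RQFOT L V) (h : Admissible F G H) (h' : Admissible F G K) :
    Admissible F G (.or H K) :=
  ⟨⟨h.1, h'.1⟩, by simp [RQ.fv, h.fv, h'.fv], Set.union_subset h.pred h'.pred,
    fun b hb => hb.elim (h.existential b) (h'.existential b),
    fun b hb => hb.elim (h.universal b) (h'.universal b)⟩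

/-- The invariant of access interpolant extraction. -/
structure IsBranchInterpolant (F G : RQFO L V) (B : List (Side × GLit L V)) (H : RQFOT L V) :
    Prop where
  admissible : Admissible F G H
  garg : ∀ s, H.garg ⊆ sideGarg F G s B
  red : ∀ (M : Type w) [L.Structure M] (e : GTerm L V → M) (a : V → M),
    BranchHolds F G .red e B → H.Sat e a
  blue : ∀ (M : Type w) [L.Structure M] (e : GTerm L V → M) (a : V → M),
    BranchHolds F G .blue e B → ¬ H.Sat e a

/-- A label that follows from the branch and has no new arguments can be dropped. This handles the
clauses for which extraction just passes on the value of a child. -/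
theorem IsBranchInterpolant.of_cons {B : List (Side × GLit L V)} {H : RQFOT L V} {s : Side}
    {l : GLit L V} (h : IsBranchInterpolant.{u, v, w, x} F G ((s, l) :: B) H)
    (hl : l.atom.parg ⊆ sideGarg F G s B)
    (hsem : ∀ (M : Type w) [L.Structure M] (e : GTerm L V → M), BranchHolds F G s e B →
      ExtHolds F G e l.atom) : IsBranchInterpolant.{u, v, w, x} F G B H := by
  have key : ∀ (s' : Side) (M : Type w) [L.Structure M] (e : GTerm L V → M),
      BranchHolds F G s' e B → BranchHolds F G s' e ((s, l) :: B) := by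
    intro s' M _ e hB
    by_cases hs : s' = s
    · subst hs
      exact hB.cons (hsem M e hB)
    · exact hB.cons_of_ne hs
  refine ⟨h.admissible, fun s' => (h.garg s').trans ?_,
    fun M _ e a hB => h.red M e a (key _ M e hB), fun M _ e a hB => h.blue M e a (key _ M e hB)⟩
  by_cases hs : s' = s
  · subst hs
    rw [sideGarg_cons_self]
    exact Set.union_subset subset_rfl hl
  · rw [sideGarg_cons_of_ne hs]

variable {T : GTab L V}

/-- By `args_step` an argument that side `s` receives only through `l` is absent from the other
side. It is then no argument of `H`, whose arguments all belong to both sides. -/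
theorem IsACITableau.garg_step (hT : IsACITableau F G T) (hs : ∀ s, (sideFml F G s).IsSentence)
    {B : List (Side × GLit L V)} {s : Side}
    {k : ℕ} {lit : Fin k → GLit L V} {sub : Fin k → GTab L V} {form : ClauseForm}
    (h : T.NodeAt B (.inner s k lit sub)) (h1 : form ≠ .unit) (h2 : form ≠ .all)
    (hc : GroundClause s (sideFml F G s) form (List.ofFn lit)) {l : GLit L V}
    (hl : l ∈ (List.ofFn lit).tail) {H : RQFOT L V}
    (hH : ∀ s', H.garg ⊆ sideGarg F G s' ((s, l) :: B)) (s' : Side) :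
    H.garg ⊆ sideGarg F G s' B := by
  obtain ⟨s₀, hs₀⟩ : ∃ s₀, s₀ ≠ s := by
    cases s
    · exact ⟨.blue, by simp⟩
    · exact ⟨.red, by simp⟩
  have hother : ∀ s₁, s₁ ≠ s → H.garg ⊆ sideGarg F G s₁ B := fun s₁ h₁ => by
    have := hH s₁
    rwa [sideGarg_cons_of_ne h₁] at this
  by_cases hs' : s' = s
  · subst hs'
    intro t ht
    have h3 := hH s' ht
    rw [sideGarg_cons_self] at h3
    rcases h3 with h3 | h3
    · exact h3
    · rcases hT.args_step hs h h1 h2 hc hl h3 with h4 | h4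
      · exact h4
      · exact (h4 s₀ hs₀ (hother s₀ hs₀ ht)).elim
  · exact hother s' hs'

/-- If the red branch holds, it extends to some child under values `e'`. The arguments of the
disjunct of that child belong to the blue side, where `e'` agrees with `e`, so the disjunct is true
under `e`. Red labels leave the blue branch unchanged, so blue refutes every disjunct. For the
clause `¬ D_p` with `⊥` at `p` there is no child to extend to: the red branch cannot hold. -/
theorem IsACITableau.isBranchInterpolant_bigOr (hT : IsACITableau F G T)
    (hs : ∀ s, (sideFml F G s).IsSentence) {B : List (Side × GLit L V)}
    {k : ℕ} {lit : Fin (k + 1) → GLit L V} {sub : Fin (k + 1) → GTab L V} {form : ClauseForm}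
    (h : T.NodeAt B (.inner .red (k + 1) lit sub)) (h1 : form ≠ .unit) (h2 : form ≠ .all)
    (hc : GroundClause .red (sideFml F G .red) form (List.ofFn lit)) {H : Fin k → RQFOT L V}
    (ih : ∀ i, IsBranchInterpolant.{u, v, w, x} F G ((.red, lit i.succ) :: B) (H i)) :
    IsBranchInterpolant.{u, v, w, x} F G B (.bigOr (List.ofFn H)) := by
  have hmem : ∀ i, lit (Fin.succ i) ∈ (List.ofFn lit).tail := fun i => by
    rw [List.ofFn_succ, List.tail_cons, List.mem_ofFn']
    exact ⟨i, rfl⟩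
  have hgarg : ∀ i s', (H i).garg ⊆ sideGarg F G s' B := fun i =>
    hT.garg_step hs h h1 h2 hc (hmem i) (ih i).garg
  refine ⟨RQ.bigOr_induction Admissible.bot Admissible.or _ ?_, fun s' =>
    RQ.bigOr_induction (P := fun H => H.garg ⊆ sideGarg F G s' B) (Set.empty_subset _)
      (fun _ _ h h' => Set.union_subset h h') _ ?_, ?_, ?_⟩
  · intro K hK
    obtain ⟨i, rfl⟩ := (List.mem_ofFn' _ _).1 hK
    exact (ih i).admissible
  · intro K hK
    obtain ⟨i, rfl⟩ := (List.mem_ofFn' _ _).1 hK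
    exact hgarg i s'
  · intro M _ e a hB
    obtain ⟨l, hl, e', hB', he'⟩ := hT.branchHolds_step hs h h1 h2 hc hB
    rw [List.ofFn_succ, List.tail_cons, List.mem_ofFn'] at hl
    obtain ⟨i, rfl⟩ := hl
    refine (RQ.sat_bigOr _).2 ⟨H i, (List.mem_ofFn' _ _).2 ⟨i, rfl⟩, ?_⟩
    exact ((H i).sat_congr (fun _ _ => rfl)
      fun t ht => he' .blue (by simp) t (hgarg i .blue ht)).1 ((ih i).red M e' a hB')
  · intro M _ e a hB hsat
    obtain ⟨K, hK, hsat⟩ := (RQ.sat_bigOr _).1 hsat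
    obtain ⟨i, rfl⟩ := (List.mem_ofFn' _ _).1 hK
    exact (ih i).blue M e a (hB.cons_of_ne (by simp)) hsat

/-- Dual to `isBranchInterpolant_bigOr`: now the blue branch picks the child, and its conjunct is
false. -/
theorem IsACITableau.isBranchInterpolant_bigAnd (hT : IsACITableau F G T)
    (hs : ∀ s, (sideFml F G s).IsSentence) {B : List (Side × GLit L V)}
    {k : ℕ} {lit : Fin (k + 1) → GLit L V} {sub : Fin (k + 1) → GTab L V} {form : ClauseForm}
    (h : T.NodeAt B (.inner .blue (k + 1) lit sub)) (h1 : form ≠ .unit) (h2 : form ≠ .all)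
    (hc : GroundClause .blue (sideFml F G .blue) form (List.ofFn lit)) {H : Fin k → RQFOT L V}
    (ih : ∀ i, IsBranchInterpolant.{u, v, w, x} F G ((.blue, lit i.succ) :: B) (H i)) :
    IsBranchInterpolant.{u, v, w, x} F G B (.bigAnd (List.ofFn H)) := by
  have hmem : ∀ i, lit (Fin.succ i) ∈ (List.ofFn lit).tail := fun i => by
    rw [List.ofFn_succ, List.tail_cons, List.mem_ofFn']
    exact ⟨i, rfl⟩
  have hgarg : ∀ i s', (H i).garg ⊆ sideGarg F G s' B := fun i =>
    hT.garg_step hs h h1 h2 hc (hmem i) (ih i).garg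
  refine ⟨RQ.bigAnd_induction Admissible.top Admissible.and _ ?_, fun s' =>
    RQ.bigAnd_induction (P := fun H => H.garg ⊆ sideGarg F G s' B) (Set.empty_subset _)
      (fun _ _ h h' => Set.union_subset h h') _ ?_, ?_, ?_⟩
  · intro K hK
    obtain ⟨i, rfl⟩ := (List.mem_ofFn' _ _).1 hK
    exact (ih i).admissible
  · intro K hK
    obtain ⟨i, rfl⟩ := (List.mem_ofFn' _ _).1 hK
    exact hgarg i s'
  · intro M _ e a hB
    refine (RQ.sat_bigAnd _).2 fun K hK => ?_
    obtain ⟨i, rfl⟩ := (List.mem_ofFn' _ _).1 hK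
    exact (ih i).red M e a (hB.cons_of_ne (by simp))
  · intro M _ e a hB hsat
    obtain ⟨l, hl, e', hB', he'⟩ := hT.branchHolds_step hs h h1 h2 hc hB
    rw [List.ofFn_succ, List.tail_cons, List.mem_ofFn'] at hl
    obtain ⟨i, rfl⟩ := hl
    refine (ih i).blue M e' a hB' (((H i).sat_congr (fun _ _ => rfl)
      fun t ht => he' .red (by simp) t (hgarg i .red ht)).2 ?_)
    exact (RQ.sat_bigAnd _).1 hsat _ ((List.mem_ofFn' _ _).2 ⟨i, rfl⟩)

/-! ### Lifting at relativized quantifiers -/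

variable {B : List (Side × GLit L V)} {s : Side} {lit : Fin 3 → GLit L V}
  {sub : Fin 3 → GTab L V} {R : Atom L (GTerm L V)} {H : RQFOT L V} {ts : Set (GTerm L V)}
  {θ : GTerm L V → V} {vs : Finset V}

theorem IsLifting.subset_parg (h : IsLifting F G s B R H ts θ vs) : ts ⊆ R.parg := by
  rw [h.1]
  exact Set.sdiff_subset

theorem IsLifting.notMem_sideGarg (h : IsLifting F G s B R H ts θ vs) {t : GTerm L V}
    (ht : t ∈ ts) : t ∉ sideGarg F G s B := by
  rw [h.1] at ht
  exact ht.2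

theorem IsLifting.mem_sideGarg_of_notMem (h : IsLifting F G s B R H ts θ vs) {t : GTerm L V}
    (hR : t ∈ R.parg) (ht : t ∉ ts) : t ∈ sideGarg F G s B := by
  by_contra h'
  rw [h.1] at ht
  exact ht ⟨hR, h'⟩

open Classical in
theorem IsLifting.relativized (h : IsLifting F G s B R H ts θ vs) (y : V) (hy : y ∈ vs) :
    (Sum.inl y : V ⊕ GTerm L V) ∈ ((R.map Sum.inr).map (Sum.elim Sum.inl fun t =>
      if t ∈ ts then Sum.inl (θ t) else Sum.inr t)).parg := by
  rw [← Finset.mem_coe, h.2.2.2] at hy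
  obtain ⟨t, ht, rfl⟩ := hy
  obtain ⟨i, rfl⟩ := h.subset_parg ht
  exact ⟨i, by simp [Atom.map, ht]⟩

/-- It serves the existential case too, since `fv` treats both quantifiers alike. -/
theorem IsLifting.fv_all (h : IsLifting F G s B R H ts θ vs) (hH : H.fv = ∅) :
    ((RQ.all vs (R.map Sum.inr) H).invSubst ts θ).fv = ∅ := by
  classical
  -- Under an empty prefix all free variables are in `vs`; the actual prefix removes them.
  have h1 := RQ.fv_invSubst_subset h.2.2.2 (RQ.all ∅ (R.map Sum.inr) H : RQFOT L V)
  have hR : RQ.atomVars (R.map Sum.inr : Atom L (V ⊕ GTerm L V)) = ∅ := by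
    ext y
    simp only [RQ.mem_atomVars, Finset.notMem_empty, iff_false]
    rintro ⟨i, hi⟩
    cases hi
  rw [show (RQ.all ∅ (R.map Sum.inr) H : RQFOT L V).fv = ∅ by simp [RQ.fv, hR, hH],
    Finset.empty_union] at h1
  refine Finset.sdiff_eq_empty_iff_subset.2 (subset_trans ?_ h1)
  exact fun y hy => Finset.mem_sdiff.2 ⟨hy, by simp⟩

/-- Lifting removes the arguments of `R` that side `s` lacks, and the new label adds to side `s` at
most arguments of `R`. On the other side nothing has to be removed, since it has all arguments of
`R`. -/
theorem IsLifting.garg_all (h : IsLifting F G s B R H ts θ vs) {l₂ : GLit L V} {s₁ : Side}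
    (hs₁ : s₁ ≠ s)
    (hl₂ : l₂.atom.parg ⊆ sideGarg F G s B ∪ R.parg) (hR : R.parg ⊆ sideGarg F G s₁ B)
    (hH : ∀ s', H.garg ⊆ sideGarg F G s' ((s, l₂) :: B)) (s' : Side) :
    (R.parg ∪ H.garg) \ ts ⊆ sideGarg F G s' B := by
  rintro t ⟨ht, hts⟩
  by_cases hs' : s' = s
  · subst hs'
    rcases ht with ht | ht
    · exact h.mem_sideGarg_of_notMem ht hts
    · have := hH s' ht
      rw [sideGarg_cons_self] at this
      rcases this with h1 | h1
      · exact h1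
      · exact (hl₂ h1).elim id fun h2 => h.mem_sideGarg_of_notMem h2 hts
  · obtain rfl : s' = s₁ := by cases s <;> cases s' <;> cases s₁ <;> simp_all
    rcases ht with ht | ht
    · exact hR ht
    · have := hH s' ht
      rwa [sideGarg_cons_of_ne hs'] at this

/-- At a position not bound by the quantifier of the clause, `R` has a constant of the formula or an
argument of `D_p`, which labels the branch with side `s`. Such a term is in `sideGarg`, so it is not
lifted and its position remains an input. -/
theorem IsACITableau.covered_of_isLifting (hT : IsACITableau F G T)
    (hN : T.NodeAt B (.inner s 3 lit sub))
    (hc : GroundClause s (sideFml F G s) .all (List.ofFn lit))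
    (hR : lit 1 = ⟨false, R.inLang LHom.sumInl⟩) (h : IsLifting F G s B R H ts θ vs)
    {f : V ⊕ GTerm L V → V ⊕ GTerm L V} (hf : ∀ t ∉ ts, f (Sum.inr t) = Sum.inr t) :
    ∃ O' : Set (Fin R.arity), (⟨false, ⟨R.arity, R.rel⟩, O'⟩ : BindingPattern L) ∈
        (sideFml F G s).bpatt ∧
      O' ⊆ {i | ∀ y ∈ vs, ((R.map Sum.inr).map f).args i ≠ Sum.inl y} := by
  obtain ⟨p, vs₀, R₀, K, μ, hp, h0, h1, -⟩ := hc.exists_of_all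
  have hD : (s, ⟨true, definerGround s p (.all vs₀ R₀ K) μ⟩) ∈ B :=
    hT.definer_mem hN (h0 ▸ (List.mem_ofFn' _ _).2 ⟨0, rfl⟩)
  rw [h1, relGround_eq_inLang, Lit.mk.injEq] at hR
  obtain rfl := Atom.inLang_injective hR.2
  refine ⟨{i | ∀ y ∈ vs₀, R₀.args i ≠ Sum.inl y},
    RQ.bpatt_subset_of_subAt hp (Or.inl rfl), fun i hi y hy => ?_⟩
  change f (Sum.inr (Sum.elim μ constTerm (R₀.args i))) ≠ _
  have hmem : Sum.elim μ constTerm (R₀.args i) ∈ sideGarg F G s B := by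
    cases hRi : R₀.args i with
    | inl z =>
      refine mem_sideGarg.2 (Or.inr ⟨_, hD, mem_parg_definerGround.2 ⟨z, ?_, rfl⟩⟩)
      have hz : z ∉ vs₀ := fun hz => hi z hz hRi
      simp only [RQ.fv, Finset.mem_sdiff, Finset.mem_union]
      exact ⟨Or.inl (RQ.mem_atomVars.2 ⟨i, hRi⟩), hz⟩
    | inr c =>
      exact mem_sideGarg.2 (Or.inl ⟨c, RQ.garg_subset_of_subAt hp (Or.inl ⟨i, hRi⟩), rfl⟩)
  rw [hf _ fun ht => h.notMem_sideGarg ht hmem]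
  simp

theorem IsACITableau.parg_subset_of_all (hT : IsACITableau F G T)
    (hs : ∀ s, (sideFml F G s).IsSentence) (hN : T.NodeAt B (.inner s 3 lit sub))
    (hc : GroundClause s (sideFml F G s) .all (List.ofFn lit)) :
    (lit 2).atom.parg ⊆ sideGarg F G s B ∪ (lit 1).atom.parg := by
  obtain ⟨p, vs₀, R₀, K, μ, hp, h0, h1, h2⟩ := hc.exists_of_all
  have hD : (s, ⟨true, definerGround s p (.all vs₀ R₀ K) μ⟩) ∈ B :=
    hT.definer_mem hN (h0 ▸ (List.mem_ofFn' _ _).2 ⟨0, rfl⟩)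
  rw [h1, h2]
  intro t ht
  refine (mem_parg_definerGround_all (p := p)
    (RQ.relativized_of_subAt hp (hs s).1) ht).imp (fun h => ?_) id
  exact mem_sideGarg.2 (Or.inr ⟨_, hD, h⟩)

theorem IsACITableau.extHolds_of_all (hT : IsACITableau F G T)
    (hN : T.NodeAt B (.inner s 3 lit sub))
    (hc : GroundClause s (sideFml F G s) .all (List.ofFn lit)) {M : Type w} [L.Structure M]
    {e : GTerm L V → M} (hB : BranchHolds F G s e B) (h : ExtHolds F G e (lit 1).atom) :
    ExtHolds F G e (lit 2).atom := by
  obtain ⟨p, vs₀, R₀, K, μ, hp, h0, h1, h2⟩ := hc.exists_of_all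
  have hD : (s, ⟨true, definerGround s p (.all vs₀ R₀ K) μ⟩) ∈ B :=
    hT.definer_mem hN (h0 ▸ (List.mem_ofFn' _ _).2 ⟨0, rfl⟩)
  rw [h2]
  refine (extHolds_definerGround (by simp [RQ.subAt_append hp, RQ.subAt]) fun _ _ => rfl).2 ?_
  refine (hB.definer_sat hp hD (e ∘ μ) fun _ _ => rfl).resolve_left (not_not.2 ?_)
  rw [h1] at h
  exact (extHolds_relGround (fun _ _ => rfl) fun c hc =>
    hB.const c (RQ.garg_subset_of_subAt hp (Or.inl hc))).1 h

/-- The values of the lifted terms are irrelevant for the branch of their own side. -/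
theorem IsACITableau.branchHolds_lift (hT : IsACITableau F G T)
    (hN : T.NodeAt B (.inner s 3 lit sub))
    (hc : GroundClause s (sideFml F G s) .all (List.ofFn lit))
    (hR : lit 1 = ⟨false, R.inLang LHom.sumInl⟩) (h : IsLifting F G s B R H ts θ vs)
    {M : Type w} [L.Structure M] {e e' : GTerm L V → M} (hB : BranchHolds F G s e B)
    (he : ∀ t, t ∉ ts → e' t = e t) (hhold : (R.map e').Holds) :
    BranchHolds F G s e' ((s, lit 2) :: B) := by
  have hB' : BranchHolds F G s e' B := hB.congr fun t ht =>
    (he t fun hts => h.notMem_sideGarg hts ht).symm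
  exact hB'.cons (hT.extHolds_of_all hN hc hB' (by rw [hR]; exact hhold))

open Classical in
/-- A valuation that maps each fresh variable to the value of the term that it replaces. -/
theorem IsLifting.exists_valuation (h : IsLifting F G s B R H ts θ vs) {M : Type w}
    (e : GTerm L V → M) (a : V → M) :
    ∃ b : V → M, (∀ y, y ∉ vs → b y = a y) ∧ ∀ t ∈ ts, e t = b (θ t) := by
  refine ⟨fun y => if hy : ∃ t ∈ ts, θ t = y then e hy.choose else a y, fun y hy => ?_,
    fun t ht => ?_⟩
  · refine dif_neg ?_
    rintro ⟨t, ht, rfl⟩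
    exact hy (by rw [← Finset.mem_coe, h.2.2.2]; exact ⟨t, ht, rfl⟩)
  · have hex : ∃ t' ∈ ts, θ t' = θ t := ⟨t, ht, rfl⟩
    exact ((dif_pos hex).trans (congrArg e (h.2.1 hex.choose_spec.1 ht hex.choose_spec.2))).symm

theorem IsACITableau.pred_of_mem (hT : IsACITableau F G T) {N : GTab L V} (hN : T.NodeAt B N)
    (h : (s, ⟨true, R.inLang LHom.sumInl⟩) ∈ B) :
    (true, ⟨R.arity, R.rel⟩) ∈ (sideFml F G s).pred := by
  rcases hT.head_of_mem hN h rfl with ⟨q, hq⟩ | ⟨P, hP, hmem⟩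
  · have : (Sum.inl ⟨R.arity, R.rel⟩ : (Σ n, L.Relations n) ⊕ (Side × List ℕ)) = Sum.inr (s, q) :=
      hq
    cases this
  · have : (Sum.inl ⟨R.arity, R.rel⟩ : (Σ n, L.Relations n) ⊕ (Side × List ℕ)) = Sum.inl P := hP
    rwa [Sum.inl_injective this]

theorem GroundClause.pred_of_all
    (hc : GroundClause s (sideFml F G s) .all (List.ofFn lit))
    (hR : lit 1 = ⟨false, R.inLang LHom.sumInl⟩) :
    (false, ⟨R.arity, R.rel⟩) ∈ (sideFml F G s).pred := by
  obtain ⟨p, vs₀, R₀, K, μ, hp, h0, h1, -⟩ := hc.exists_of_all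
  rw [h1, relGround_eq_inLang, Lit.mk.injEq] at hR
  obtain rfl := Atom.inLang_injective hR.2
  exact RQ.pred_subset_of_subAt hp (Or.inl rfl)

/-- Red: the lifted terms are not red arguments, so they can take any values of the quantified
variables; if `R` holds for these, the clause makes its last literal true and the induction
hypothesis applies. Blue: `R` is a true label, so instantiating the quantifier by the current values
of the lifted terms yields `H`, which the induction hypothesis refutes. -/
theorem IsACITableau.isBranchInterpolant_all (hT : IsACITableau F G T)
    (hs : ∀ s, (sideFml F G s).IsSentence) (hN : T.NodeAt B (.inner .red 3 lit sub))
    (hc : GroundClause .red (sideFml F G .red) .all (List.ofFn lit))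
    (htgt : (.blue, (lit 1).compl) ∈ B) (hR : lit 1 = ⟨false, R.inLang LHom.sumInl⟩)
    (h : IsLifting F G .red B R H ts θ vs)
    (ih : IsBranchInterpolant.{u, v, w, x} F G ((.red, lit 2) :: B) H) :
    IsBranchInterpolant.{u, v, w, x} F G B ((RQ.all vs (R.map Sum.inr) H).invSubst ts θ) := by
  classical
  have htgt' : (Side.blue, (⟨true, R.inLang LHom.sumInl⟩ : GLit L V)) ∈ B := by
    rw [hR] at htgt
    exact htgt
  have hbp := RQ.bpatt_invSubst H h.2.2.1
  have hargs := hT.parg_subset_of_all hs hN hc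
  rw [hR] at hargs
  refine ⟨⟨⟨h.relativized, RQ.relativized_mapArgs (fun _ => rfl) ih.admissible.relativized⟩,
    h.fv_all ih.admissible.fv, ?_, ?_, ?_⟩, ?_, ?_, ?_⟩
  · refine (RQ.pred_mapArgs _ _).subset.trans (Set.union_subset ?_ ih.admissible.pred)
    rintro _ rfl
    -- The clause shows `R` negative in `F`. The blue label shows it positive in `¬ G`, hence
    -- negative in `G`.
    exact ⟨hc.pred_of_all hR, (RQ.mem_pred_neg G).1 (hT.pred_of_mem hN htgt')⟩
  · rintro b (rfl | hb) hb'
    · cases hb'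
    · exact ih.admissible.existential b (hbp ▸ hb) hb'
  · rintro b (rfl | hb) hb'
    · obtain ⟨O', hO', hsub⟩ := hT.covered_of_isLifting hN hc hR h
        (f := Sum.elim Sum.inl fun t => if t ∈ ts then Sum.inl (θ t) else Sum.inr t)
        (fun t ht => by simp [ht])
      exact ⟨_, hO', .mk _ _ _ _ hsub⟩
    · exact ih.admissible.universal b (hbp ▸ hb) hb'
  · intro s'
    rw [RQ.garg_invSubst]
    have := h.garg_all (s₁ := .blue) (by simp) hargs
      (fun t ht => mem_sideGarg.2 (Or.inr ⟨_, htgt', ht⟩)) ih.garg s'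
    simpa only [RQ.garg, parg_map_inr, Set.ofPred_mem_eq] using this
  · intro M _ e a hB b hb
    -- The lifted terms take the values of the variables that replace them.
    let e' : GTerm L V → M := fun t => if t ∈ ts then b (θ t) else e t
    have h1 : ∀ t ∈ ts, e' t = b (θ t) := fun t ht => if_pos ht
    have h2 : ∀ t, t ∉ ts → e' t = e t := fun t ht => if_neg ht
    rw [← imp_iff_not_or]
    intro hhold
    refine (RQ.sat_invSubst H h.2.2.1 h1 h2).2 (ih.red M e' b ?_)
    exact hT.branchHolds_lift hN hc hR h hB h2 ((holds_map_invSubst R h1 h2).1 hhold)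
  · intro M _ e a hB hsat
    obtain ⟨b, hb, h1⟩ := h.exists_valuation e a
    rcases hsat b hb with hn | hsat
    · exact hn ((holds_map_invSubst R h1 fun _ _ => rfl).2 (hB.labels _ htgt'))
    · exact ih.blue M e b (hB.cons_of_ne (by simp))
        ((RQ.sat_invSubst H h.2.2.1 h1 fun _ _ => rfl).1 hsat)

/-- Dual: the current values of the lifted terms are the witnesses when red holds, and blue refutes
`H` for all their values that satisfy `R`. -/
theorem IsACITableau.isBranchInterpolant_ex (hT : IsACITableau F G T)
    (hs : ∀ s, (sideFml F G s).IsSentence) (hN : T.NodeAt B (.inner .blue 3 lit sub))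
    (hc : GroundClause .blue (sideFml F G .blue) .all (List.ofFn lit))
    (htgt : (.red, (lit 1).compl) ∈ B) (hR : lit 1 = ⟨false, R.inLang LHom.sumInl⟩)
    (h : IsLifting F G .blue B R H ts θ vs)
    (ih : IsBranchInterpolant.{u, v, w, x} F G ((.blue, lit 2) :: B) H) :
    IsBranchInterpolant.{u, v, w, x} F G B ((RQ.ex vs (R.map Sum.inr) H).invSubst ts θ) := by
  classical
  have htgt' : (Side.red, (⟨true, R.inLang LHom.sumInl⟩ : GLit L V)) ∈ B := by
    rw [hR] at htgt
    exact htgt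
  have hbp := RQ.bpatt_invSubst H h.2.2.1
  have hargs := hT.parg_subset_of_all hs hN hc
  rw [hR] at hargs
  refine ⟨⟨⟨h.relativized, RQ.relativized_mapArgs (fun _ => rfl) ih.admissible.relativized⟩,
    h.fv_all ih.admissible.fv, ?_, ?_, ?_⟩, ?_, ?_, ?_⟩
  · refine (RQ.pred_mapArgs _ _).subset.trans (Set.union_subset ?_ ih.admissible.pred)
    rintro _ rfl
    exact ⟨hT.pred_of_mem hN htgt', (RQ.mem_pred_neg G).1 (hc.pred_of_all hR)⟩
  · rintro b (rfl | hb) hb'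
    · obtain ⟨O', hO', hsub⟩ := hT.covered_of_isLifting hN hc hR h
        (f := Sum.elim Sum.inl fun t => if t ∈ ts then Sum.inl (θ t) else Sum.inr t)
        (fun t ht => by simp [ht])
      exact ⟨_, (RQ.mem_bpatt_neg G).1 hO', .mk _ _ _ _ hsub⟩
    · exact ih.admissible.existential b (hbp ▸ hb) hb'
  · rintro b (rfl | hb) hb'
    · cases hb'
    · exact ih.admissible.universal b (hbp ▸ hb) hb'
  · intro s'
    rw [RQ.garg_invSubst]
    have := h.garg_all (s₁ := .red) (by simp) hargs
      (fun t ht => mem_sideGarg.2 (Or.inr ⟨_, htgt', ht⟩)) ih.garg s'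
    simpa only [RQ.garg, parg_map_inr, Set.ofPred_mem_eq] using this
  · intro M _ e a hB
    obtain ⟨b, hb, h1⟩ := h.exists_valuation e a
    exact ⟨b, hb, (holds_map_invSubst R h1 fun _ _ => rfl).2 (hB.labels _ htgt'),
      (RQ.sat_invSubst H h.2.2.1 h1 fun _ _ => rfl).2 (ih.red M e b (hB.cons_of_ne (by simp)))⟩
  · rintro M _ e a hB ⟨b, hb, hhold, hsat⟩
    let e' : GTerm L V → M := fun t => if t ∈ ts then b (θ t) else e t
    have h1 : ∀ t ∈ ts, e' t = b (θ t) := fun t ht => if_pos ht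
    have h2 : ∀ t, t ∉ ts → e' t = e t := fun t ht => if_neg ht
    refine ih.blue M e' b ?_ ((RQ.sat_invSubst H h.2.2.1 h1 h2).1 hsat)
    exact hT.branchHolds_lift hN hc hR h hB h2 ((holds_map_invSubst R h1 h2).1 hhold)

theorem IsACITableau.isBranchInterpolant (hT : IsACITableau F G T)
    (hs : ∀ s, (sideFml F G s).IsSentence) {B : List (Side × GLit L V)} {N : GTab L V}
    {H : RQFOT L V} (h : IsAipol F G B N H) (hN : T.NodeAt B N) :
    IsBranchInterpolant.{u, v, w, x} F G B H := by
  induction h with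
  | @unit B s lit sub H hc h ih =>
    have hlit : ∃ μ : V → GTerm L V, lit 0 = ⟨true, definerGround s [] (sideFml F G s) μ⟩ := by
      have h' := hc.groundClause
      generalize hc' : List.ofFn lit = c at h'
      cases h' with
      | unit μ =>
        simp only [List.ofFn_succ, List.ofFn_zero, List.cons.injEq, and_true] at hc'
        exact ⟨μ, hc'⟩
    obtain ⟨μ, hμ⟩ := hlit
    refine (ih (hN.child 0)).of_cons ?_ fun M _ e hB => ?_
    · rw [hμ]
      intro t ht
      obtain ⟨y, hy, -⟩ := mem_parg_definerGround.1 ht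
      simp [(hs s).2] at hy
    · rw [hμ]
      exact (extHolds_definerGround (by simp [RQ.subAt]) fun _ _ => rfl).2 (hB.sat _)
  | disj hform hc h ih =>
    exact hT.isBranchInterpolant_bigOr hs hN hform.1 hform.2 hc.groundClause
      fun i => ih i (hN.child i.succ)
  | conj hform hc h ih =>
    exact hT.isBranchInterpolant_bigAnd hs hN hform.1 hform.2 hc.groundClause
      fun i => ih i (hN.child i.succ)
  | sameSide hc htgt h ih =>
    refine (ih (hN.child 2)).of_cons ?_ fun M _ e hB => ?_
    · refine (hT.parg_subset_of_all hs hN hc.groundClause).trans (Set.union_subset subset_rfl ?_)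
      exact fun t ht => mem_sideGarg.2 (Or.inr ⟨_, htgt, ht⟩)
    · exact hT.extHolds_of_all hN hc.groundClause hB (hB.labels (Lit.compl _) htgt)
  | all hc htgt hR h hθ ih =>
    exact hT.isBranchInterpolant_all hs hN hc.groundClause htgt hR hθ (ih (hN.child 2))
  | ex hc htgt hR h hθ ih =>
    exact hT.isBranchInterpolant_ex hs hN hc.groundClause htgt hR hθ (ih (hN.child 2))

/-! ### Extraction is defined -/

/-- Finitely many terms are lifted and finitely many variables occur in `H`, while `V` is infinite.
-/
theorem exists_isLifting [Infinite V] (F G : RQFO L V) (s : Side) (B : List (Side × GLit L V))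
    (R : Atom L (GTerm L V)) (H : RQFOT L V) : ∃ ts θ vs, IsLifting F G s B R H ts θ vs := by
  classical
  let ts : Set (GTerm L V) :=
    R.parg \ (Fml.and (defForm s (sideFml F G s)) (branchFml s B)).garg
  have hfin : ts.Finite := (Set.finite_range R.args).subset Set.sdiff_subset
  have hinf : (H.vars : Set V)ᶜ.Infinite := H.vars.finite_toSet.infinite_compl
  have : Finite ts := hfin
  have : Infinite ((H.vars : Set V)ᶜ : Set V) := hinf.to_subtype
  let f : ts → ((H.vars : Set V)ᶜ : Set V) := fun t =>
    Infinite.natEmbedding _ (Finite.equivFin ts t)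
  have hf : Function.Injective f := (Infinite.natEmbedding _).injective.comp
    (Fin.val_injective.comp (Finite.equivFin ts).injective)
  let θ : GTerm L V → V := fun t => if ht : t ∈ ts then f ⟨t, ht⟩ else Classical.arbitrary V
  have hθ : ∀ t (ht : t ∈ ts), θ t = f ⟨t, ht⟩ := fun t ht => dif_pos ht
  refine ⟨ts, θ, (hfin.image θ).toFinset, rfl, ?_, ?_, by simp⟩
  · intro t ht t' ht' heq
    rw [hθ t ht, hθ t' ht'] at heq
    exact congrArg Subtype.val (hf (Subtype.val_injective heq))
  · intro t ht
    rw [hθ t ht]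
    exact (f ⟨t, ht⟩).2

/-- Extraction recurs only on children with positive literals, and these are inner nodes. The
ancestor complementary to the relativizing literal exists because that literal is negative. -/
theorem IsACITableau.exists_isAipol [Infinite V] (hT : IsACITableau F G T) (N : GTab L V)
    (B : List (Side × GLit L V)) (hN : T.NodeAt B N) (hleaf : N ≠ .leaf) :
    ∃ H, IsAipol F G B N H := by
  induction N generalizing B with
  | leaf => exact (hleaf rfl).elim
  | inner s k lit sub ih =>
    have hpos : ∀ i, (lit i).sign = true → ∃ H, IsAipol F G ((s, lit i) :: B) (sub i) H :=
      fun i hi => ih i _ (hN.child i) (hT.ne_leaf hN i hi)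
    obtain ⟨form, hform⟩ := hT.tableau _ _ _ _ _ hN
    have hc := hform.groundClause
    by_cases h1 : form = .unit
    · subst h1
      generalize hl : List.ofFn lit = c at hc
      cases hc with
      | unit μ =>
        obtain rfl : k = 1 := by simpa using congrArg List.length hl
        simp only [List.ofFn_succ, List.ofFn_zero, List.cons.injEq, and_true] at hl
        obtain ⟨H, hH⟩ := hpos 0 (by rw [hl])
        exact ⟨H, .unit hform hH⟩
    by_cases h2 : form = .all
    · subst h2
      obtain rfl : k = 3 := by
        generalize hl : List.ofFn lit = c at hc
        cases hc with
        | all hp μ => simpa using congrArg List.length hl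
      obtain ⟨p, vs, R, K, μ, hp, -, h1, h2⟩ := hc.exists_of_all
      obtain ⟨H, hH⟩ := hpos 2 (by rw [h2])
      obtain ⟨s', htgt⟩ := hT.compl_mem hN ((List.mem_ofFn' _ _).2 ⟨1, rfl⟩) (by rw [h1])
      by_cases hss : s' = s
      · subst hss
        exact ⟨H, .sameSide hform htgt hH⟩
      · obtain ⟨ts, θ, ws, hθ⟩ :=
          exists_isLifting F G s B (R.map (Sum.elim μ constTerm)) H
        cases s with
        | red =>
          obtain rfl : s' = .blue := by cases s' <;> simp_all
          exact ⟨_, .all hform htgt (h1.trans (by rw [relGround_eq_inLang])) hH hθ⟩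
        | blue =>
          obtain rfl : s' = .red := by cases s' <;> simp_all
          exact ⟨_, .ex hform htgt (h1.trans (by rw [relGround_eq_inLang])) hH hθ⟩
    · obtain ⟨l, ls, hl, hls⟩ := hc.signs h1 h2
      obtain ⟨k, rfl⟩ : ∃ k', k = k' + 1 := ⟨ls.length, by simpa using congrArg List.length hl⟩
      have hpos' : ∀ i : Fin k, ∃ H, IsAipol F G ((s, lit i.succ) :: B) (sub i.succ) H := by
        intro i
        refine hpos _ (hls _ ?_)
        rw [List.ofFn_succ, List.cons.injEq] at hl
        rw [← hl.2, List.mem_ofFn']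
        exact ⟨i, rfl⟩
      choose H hH using hpos'
      cases s with
      | red => exact ⟨_, .disj ⟨h1, h2⟩ hform hH⟩
      | blue => exact ⟨_, .conj ⟨h1, h2⟩ hform hH⟩

/-- A branch interpolant at the root is an access interpolant. -/
theorem IsBranchInterpolant.isAccessInterpolant
    (hs : ∀ s, (sideFml F G s).IsSentence) {H : RQFOT L V}
    (h : IsBranchInterpolant.{u, v, w, x} F G [] H) :
    ∃ H' : RQFO L V, H = H'.toRQFOT ∧ IsAccessInterpolant.{u, v, w, x} F G H' := by
  have hgarg : ∀ s, H.garg ⊆ constTerm '' (sideFml F G s).garg := by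
    intro s t ht
    rcases mem_sideGarg.1 (h.garg s ht) with ⟨c, hc, rfl⟩ | ⟨l, hl, -⟩
    · exact ⟨c, hc, rfl⟩
    · simp at hl
  obtain ⟨H', hH'⟩ := RQ.exists_mapArgs_eq (constTerm : L.Constants → GTerm L V) H
    fun t ht => Set.image_subset_range _ _ (hgarg .red ht)
  subst hH'
  have hgarg' : ∀ s, H'.garg ⊆ (sideFml F G s).garg := by
    intro s
    have := hgarg s
    rwa [RQ.garg_mapArgs_inr, Set.image_subset_image_iff constTerm_injective] at this
  obtain ⟨h1, h2, h3, h4, h5⟩ := h.admissible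
  rw [RQ.relativized_mapArgs_inr] at h1
  rw [RQ.fv_mapArgs_inr] at h2
  rw [RQ.pred_mapArgs] at h3
  rw [RQ.bpatt_mapArgs_inr] at h4 h5
  -- On the empty branch only the formula of the side matters. As it is a sentence, its truth does
  -- not depend on the valuation.
  have hhold : ∀ (s : Side) (M : Type w) [L.Structure M] (e : GTerm L V → M) (a : V → M),
      (∀ c : L.Constants, e (constTerm c) = (c : M)) →
      (sideFml F G s).Sat (fun c : L.Constants => (c : M)) a → BranchHolds F G s e [] := by
    intro s M _ e a he hsat
    refine ⟨fun a' => ?_, fun c _ => he c, by simp⟩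
    exact (RQ.sat_congr _ (by simp [(hs s).2]) fun _ _ => rfl).1 hsat
  refine ⟨H', rfl, ⟨h1, h2⟩, ?_, ?_, h3, h4, h5, ?_⟩
  · intro M _ _ a hsat
    -- Only the values of constants matter; other terms get an arbitrary element of the non-empty
    -- domain.
    obtain ⟨e, he⟩ := exists_eval_constTerm (L := L) (V := V) M
    have := (RQ.sat_mapArgs_inr _ _).1 (h.red M e a (hhold .red M e a he hsat))
    rwa [show e ∘ constTerm = fun c : L.Constants => (c : M) from funext he] at this
  · intro M _ _ a hsat
    obtain ⟨e, he⟩ := exists_eval_constTerm (L := L) (V := V) M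
    by_contra hG
    refine h.blue M e a (hhold .blue M e a he ((RQ.sat_neg G).2 hG)) ((RQ.sat_mapArgs_inr _ _).2 ?_)
    rwa [show e ∘ constTerm = fun c : L.Constants => (c : M) from funext he]
  · refine Set.subset_inter (hgarg' .red) ?_
    have := hgarg' .blue
    rwa [show sideFml F G .blue = G.neg from rfl, RQ.garg_neg] at this

end Invariant

end AccessInterpolation

/-! ### Access interpolants from tableaux -/

open AccessInterpolation in
theorem mainTheorem3 {L : FirstOrder.Language.{u, v}} {V : Type x} [LinearOrder V] [Infinite V]
    (F G : RQFO L V) (hF : F.IsSentence) (hG : G.IsSentence) (hFG : Entails.{u, v, w, x} F G)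
    (T : GTab L V) (hT : IsACITableau F G T) :
    (∃ H, IsAipol F G [] T H) ∧
      ∀ H, IsAipol F G [] T H →
        ∃ H' : RQFO L V, H = H'.toRQFOT ∧ IsAccessInterpolant.{u, v, w, x} F G H' := by
  have hs : ∀ s, (sideFml F G s).IsSentence := by
    rintro (_ | _)
    · exact hF
    · exact ⟨(RQ.relativized_neg G).2 hG.1, (RQ.fv_neg G).trans hG.2⟩
  refine ⟨hT.exists_isAipol T [] .root ?_, fun H hH =>
    (hT.isBranchInterpolant hs hH .root).isAccessInterpolant hs⟩
  -- The root is not a leaf: it has no label, so it could not be closed.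
  rintro rfl
  obtain ⟨s, l, B', h, -⟩ := hT.closed [] .root
  cases h
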